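/- **Setting.** Simple types are generated by $\sigma,\tau ::= o \mid \sigma\to\tau$. Let $\Sigma$ be a ranked alphabet; a symbol of arity $n$ is a constant of type $o\to\cdots\to o\to o$ ($n$ arguments). *Recursion schemes.* A higher-order recursion scheme $\mathcal G$ over $\Sigma$ consists of a finite set $\mathcal N$ of simply-typed non-terminals, a start symbol $S\in\mathcal N$ of type $o$, and for each $F\in\mathcal N$ a term $\mathcal R(F)=\lambda x_1\ldots\lambda x_n.\,t$ of the same type as $F$, where $t$ has type $o$, contains no abstraction, and is built by application from symbols of $\Sigma$, non-terminals and $x_1,\dots,x_n$. It induces the rewrite rules $F\,t_1\cdots t_n\to t[x_i\leftarrow t_i]$, applicable anywhere in a term. The value tree $\langle\mathcal G\rangle$ is the partial $\Sigma$-labelled ranked tree in which position $p$ carries $a$ iff $S$ rewrites in finitely many steps to a term whose position $p$ is reached through symbols of $\Sigma$ only and carries $a$. (Positions at which the computation diverges carry no symbol.) *Automata.* An alternating parity tree automaton $\mathcal A$ over $\Sigma$ has a finite set $Q$ of states, a colouring $\Omega:Q\to\mathbb N$, and for $q\in Q$, $a\in\Sigma$ of arity $n$ a finite disjunction $\delta(q,a)$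 of conjunctive clauses, a clause being a finite set of pairs $(d,q')\in\{1,\dots,n\}\times Q$. A run-tree over a tree $T$ with initial state $q_0$ is a finitely branching tree whose nodes are labelled by pairs (position of $T$, state), with root labelled $(\text{root},q_0)$, such that for every node labelled $(p,q)$ the position $p$ carries a symbol $a$ in $T$ and, for some clause $\varphi$ of $\delta(q,a)$, the labels of its children are exactly the pairs $(p\cdot d,q')$ with $(d,q')\in\varphi$. It is accepting if along each infinite branch the greatest colour $\Omega(q)$ occurring infinitely often is even. *The model.* $\mathbf{FinScottL}$ has finite preorders as objects, and as morphisms $A\to B$ the relations $R\subseteq A\times B$ such that $(a,b)\in R$, $a\le a'$, $b'\le b$ imply $(a',b')\in R$; composition is relational. Put $A\otimes B=A\times B$, $A\multimap B=A^{op}\times B$, and let products $\&$ be disjoint unions, with $\top=\emptyset$. The comonad $!$ sends $A$ to its finite subsets, with $u\le v$ iff $\forall a\in u\,\exists b\in v\; a\le b$. Let $Col=\Omega(Q)\uplus\{\epsilon\}$ with $\epsilon$ below all other colours; the comonad $\Box$ sends $A$ to $Col\times A$, with $(c,a)\le(c',a')$ iff $c=c'$ and $a\le a'$, counit $\{((\epsilon,a),a')\mid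 a'\le a\}$ and comultiplication $\{((\max(c_1,c_2),a),(c_1,(c_2,a')))\mid a'\le a\}$. The distributive law $\{(\{(c_j,a'_j)\},(c,\{a_i\}))\mid\forall i\,\exists j\; c=c_j,\ a_i\le a'_j\}:{!}\Box A\to\Box{!}A$ makes ${!}\Box$ a comonad, whose Kleisli category is cartesian closed. Types are interpreted by $[\![o]\!]=(Q,=)$ and $[\![\sigma\to\tau]\!]={!}\Box[\![\sigma]\!]\multimap[\![\tau]\!]$, abstraction-free terms and the abstractions in $\mathcal R(F)$ by the cartesian closed structure, and $a\in\Sigma$ of arity $n$ by the set of $(\alpha_1,\dots,\alpha_n,q)$ for which some clause $\varphi$ of $\delta(q,a)$ satisfies $(\Omega(q'),q')\in\alpha_k$ for all $(k,q')\in\varphi$. *Fixpoints.* Let $R:{!}\Box X\otimes{!}\Box A\to A$. A semantic run-tree of $R$ producing $a$ is a finitely branching tree whose nodes have a label in $X\uplus A$ and a colour in $Col$; the root has label $a$ and colour $\epsilon$; nodes labelled in $X$ are leaves; and for each node labelled $b\in A$, if $u$ and $v$ are the sets of (colour, label) of its children labelled in $X$ and in $A$ respectively, then $((u,v),b)\in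 R$. It is winning if along each infinite branch some colour other than $\epsilon$ occurs infinitely often and the greatest such colour is even. Then $\mathbf Y_{X,A}(R)$ is the set of pairs $(u,a)$ for which there is a winning semantic run-tree of $R$ producing $a$ such that $u$ is the set of pairs $(c,x)$ with $x\in X$ the label of a leaf and $c$ the greatest colour on the path from the root to it (both included). The interpretation $[\![\mathcal G]\!]_{\mathcal A}\subseteq Q$ is the $S$-component of $\mathbf Y_{\top,N}(R)$, where $N$ is the product of the interpretations of the types of the non-terminals and $R:{!}\Box\top\otimes{!}\Box N\to N$ is given by the interpretations of the $\mathcal R(F)$, $F\in\mathcal N$. **Theorem.** Let $\mathcal G$ be a higher-order recursion scheme and $\mathcal A$ an alternating parity tree automaton over the same ranked alphabet $\Sigma$, and let $q_0$ be a state of $\mathcal A$. Then $\mathcal A$ has an accepting run-tree with initial state $q_0$ over the value tree $\langle\mathcal G\rangle$ if and only if $q_0\in[\![\mathcal G]\!]_{\mathcal A}$. -/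

import Mathlib

open CategoryTheory

namespace HOMC

/-! ### The category of finite preorders and downward-closed relations -/

/-- An object of `FinScottL`: a finite preordered set. -/
structure FinScottL where
  carrier : Type
  [pre : Preorder carrier]
  [fin : Finite carrier]

namespace FinScottL

attribute [instance] FinScottL.pre FinScottL.fin

instance : CoeSort FinScottL Type := ⟨FinScottL.carrier⟩

/-- A morphism `A ⟶ B`: a relation that is downward closed in `Aᵒᵖ × B`. -/
@[ext]
structure Hom (A B : FinScottL) where
  rel : A → B → Prop
  down : ∀ {a a' : A} {b b' : B}, rel a b → a ≤ a' → b' ≤ b → rel a' b'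

instance : Category FinScottL where
  Hom := Hom
  id _ := ⟨fun a' a => a ≤ a', fun h h1 h2 => h2.trans (h.trans h1)⟩
  comp R S := ⟨fun a c => ∃ b, R.rel a b ∧ S.rel b c,
    fun ⟨b, hR, hS⟩ h1 h2 => ⟨b, R.down hR h1 le_rfl, S.down hS le_rfl h2⟩⟩
  id_comp R := Hom.ext (funext fun _ => funext fun _ => propext
    ⟨fun ⟨_, h, hR⟩ => R.down hR h le_rfl, fun hR => ⟨_, le_rfl, hR⟩⟩)
  comp_id R := Hom.ext (funext fun _ => funext fun _ => propext
    ⟨fun ⟨_, hR, h⟩ => R.down hR le_rfl h, fun hR => ⟨_, hR, le_rfl⟩⟩)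
  assoc _ _ _ := Hom.ext (funext fun _ => funext fun _ => propext
    ⟨fun ⟨c, ⟨b, hR, hS⟩, hT⟩ => ⟨b, hR, c, hS, hT⟩,
     fun ⟨b, hR, c, hS, hT⟩ => ⟨c, ⟨b, hR, hS⟩, hT⟩⟩)

theorem hom_ext {A B : FinScottL} {R S : A ⟶ B} (h : ∀ a b, R.rel a b ↔ S.rel a b) : R = S :=
  Hom.ext (funext fun a => funext fun b => propext (h a b))

theorem id_rel {A : FinScottL} {a' a : A} : Hom.rel (𝟙 A) a' a ↔ a ≤ a' := Iff.rfl

theorem comp_rel {A B D : FinScottL} {R : A ⟶ B} {S : B ⟶ D} {a : A} {c : D} :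
    (R ≫ S).rel a c ↔ ∃ b, R.rel a b ∧ S.rel b c := Iff.rfl

/-- The object given by an explicit reflexive and transitive relation on a finite set. -/
abbrev ofRel (X : Type) [Finite X] (le : X → X → Prop) (refl : ∀ x, le x x)
    (trans : ∀ x y z, le x y → le y z → le x z) : FinScottL :=
  @FinScottL.mk X
    { le := le, lt := fun x y => le x y ∧ ¬ le y x, le_refl := refl, le_trans := trans,
      lt_iff_le_not_ge := fun _ _ => Iff.rfl } _

/-- The discrete preorder `(Q, =)`. -/
def discrete (Q : Type) [Finite Q] : FinScottL :=
  ofRel Q Eq (fun _ => rfl) (fun _ _ _ => Eq.trans)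

/-- The terminal object `⊤ = (∅, ∅)`. -/
def top : FinScottL := discrete Empty

/-- The tensor product, with the componentwise order. -/
def tensor (A B : FinScottL) : FinScottL := ⟨A × B⟩

/-- The linear arrow `A ⊸ B = Aᵒᵖ × B`. -/
def lolli (A B : FinScottL) : FinScottL :=
  ofRel (A × B) (fun x y => y.1 ≤ x.1 ∧ x.2 ≤ y.2)
    (fun _ => ⟨le_rfl, le_rfl⟩)
    (fun _ _ _ h k => ⟨k.1.trans h.1, h.2.trans k.2⟩)

/-- The binary product `A & B`: the disjoint union, elements of different summands being
incomparable. -/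
def prod (A B : FinScottL) : FinScottL := ⟨A ⊕ B⟩

/-- The product of a finite family: the disjoint union. -/
def pi {ι : Type} [Finite ι] (A : ι → FinScottL) : FinScottL := ⟨Σ i, A i⟩

/-- First projection. -/
def fst (A B : FinScottL) : prod A B ⟶ A where
  rel x a := ∃ a' : A, x = Sum.inl a' ∧ a ≤ a'
  down := by
    rintro x x' a b ⟨a', rfl, h⟩ hx hb
    cases hx with
    | inl hx => exact ⟨_, rfl, hb.trans (h.trans hx)⟩

/-- Second projection. -/
def snd (A B : FinScottL) : prod A B ⟶ B where
  rel x b := ∃ b' : B, x = Sum.inr b' ∧ b ≤ b'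
  down := by
    rintro x x' a b ⟨a', rfl, h⟩ hx hb
    cases hx with
    | inr hx => exact ⟨_, rfl, hb.trans (h.trans hx)⟩

/-- Projections of a finite product. -/
def proj {ι : Type} [Finite ι] (A : ι → FinScottL) (i : ι) : pi A ⟶ A i where
  rel x a := ∃ a' : A i, x = ⟨i, a'⟩ ∧ a ≤ a'
  down := by
    rintro x x' a b ⟨a', rfl, h⟩ hx hb
    cases hx with
    | fiber _ _ _ hx => exact ⟨_, rfl, hb.trans (h.trans hx)⟩

/-- Tupling into a finite product. -/
def tuple {ι : Type} [Finite ι] {D : FinScottL} {A : ι → FinScottL} (R : ∀ i, D ⟶ A i) :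
    D ⟶ pi A where
  rel d x := (R x.1).rel d x.2
  down := by
    rintro d d' x x' h hd hx
    cases hx with
    | fiber _ _ _ hx => exact (R _).down h hd hx

/-! ### The exponential modality -/

/-- `!A`: finite subsets, where `u ≤ v` iff every element of `u` is below an element of `v`. -/
def bangObj (A : FinScottL) : FinScottL :=
  ofRel (Finset A) (fun u v => ∀ a ∈ u, ∃ b ∈ v, a ≤ b)
    (fun _ a ha => ⟨a, ha, le_rfl⟩)
    (fun _ _ _ h k a ha =>
      let ⟨b, hb, hab⟩ := h a ha
      let ⟨c, hc, hbc⟩ := k b hb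
      ⟨c, hc, hab.trans hbc⟩)

/-- The action of `!` on morphisms. -/
def bangMap {A B : FinScottL} (R : A ⟶ B) : bangObj A ⟶ bangObj B where
  rel (u : Finset A) (v : Finset B) := ∀ b ∈ v, ∃ a ∈ u, R.rel a b
  down := by
    intro u u' v v' h hu hv b hb
    obtain ⟨b1, hb1, hbb⟩ := hv b hb
    obtain ⟨a, ha, hab⟩ := h b1 hb1
    obtain ⟨a1, ha1, haa⟩ := hu a ha
    exact ⟨a1, ha1, R.down hab haa hbb⟩

/-- The dereliction `!A ⟶ A`. -/
def bangDer (A : FinScottL) : bangObj A ⟶ A where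
  rel (u : Finset A) a := ∃ a' ∈ u, a ≤ a'
  down := by
    rintro u u' a b ⟨a', ha', h⟩ hu hb
    obtain ⟨a1, ha1, haa⟩ := hu a' ha'
    exact ⟨a1, ha1, hb.trans (h.trans haa)⟩

/-- The digging `!A ⟶ !!A`. -/
def bangDig (A : FinScottL) : bangObj A ⟶ bangObj (bangObj A) where
  rel (u : bangObj A) (U : Finset (bangObj A)) := ∀ v ∈ U, v ≤ u
  down := by
    intro u u' U U' h hu hU v hv
    obtain ⟨v1, hv1, hvv⟩ := hU v hv
    exact hvv.trans ((h v1 hv1).trans hu)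

/-- In a finite set every predicate carves out a finite subset. -/
theorem exists_finset {α : Type} [Finite α] (p : α → Prop) :
    ∃ s : Finset α, ∀ x, x ∈ s ↔ p x :=
  ⟨(Set.toFinite {x | p x}).toFinset, by simp⟩

/-- The comonad `!`. -/
def bang : Comonad FinScottL where
  obj := bangObj
  map := bangMap
  map_id A := hom_ext fun u v => Iff.rfl
  map_comp {A B D} R S := hom_ext fun u w => by
    constructor
    · intro h
      obtain ⟨v, hv⟩ := exists_finset fun b : B => ∃ a ∈ (show Finset A from u), R.rel a b
      refine ⟨v, fun b hb => (hv b).1 hb, fun c hc => ?_⟩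
      obtain ⟨a, ha, b, hab, hbc⟩ := h c hc
      exact ⟨b, (hv b).2 ⟨a, ha, hab⟩, hbc⟩
    · rintro ⟨v, h, k⟩ c hc
      obtain ⟨b, hb, hbc⟩ := k c hc
      obtain ⟨a, ha, hab⟩ := h b hb
      exact ⟨a, ha, b, hab, hbc⟩
  ε :=
    { app := bangDer
      naturality := fun A B R => hom_ext fun u b => by
        constructor
        · rintro ⟨v, h, b', hb', hbb⟩
          obtain ⟨a, ha, hab⟩ := h b' hb'
          exact ⟨a, ⟨a, ha, le_rfl⟩, R.down hab le_rfl hbb⟩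
        · rintro ⟨a, ⟨a', ha', haa⟩, hab⟩
          refine ⟨({b} : Finset B), fun b' hb' => ?_, b, Finset.mem_singleton_self b, le_rfl⟩
          obtain rfl := Finset.mem_singleton.1 hb'
          exact ⟨a', ha', R.down hab haa le_rfl⟩ }
  δ :=
    { app := bangDig
      naturality := fun A B R => hom_ext fun u V => by
        constructor
        · rintro ⟨v, h, hV⟩
          refine ⟨({u} : Finset (bangObj A)), fun u' hu' => ?_, fun v' hv' =>
            ⟨u, Finset.mem_singleton_self u, fun b hb => ?_⟩⟩
          · obtain rfl := Finset.mem_singleton.1 hu'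
            exact le_rfl
          · obtain ⟨b', hb', hbb⟩ := hV v' hv' b hb
            obtain ⟨a, ha, hab⟩ := h b' hb'
            exact ⟨a, ha, R.down hab le_rfl hbb⟩
        · rintro ⟨U, hU, h⟩
          obtain ⟨v, hv⟩ := exists_finset fun b : B => ∃ a ∈ (show Finset A from u), R.rel a b
          refine ⟨v, fun b hb => (hv b).1 hb, fun v' hv' b hb => ⟨b, (hv b).2 ?_, le_rfl⟩⟩
          obtain ⟨u', hu', hR⟩ := h v' hv'
          obtain ⟨a, ha, hab⟩ := hR b hb
          obtain ⟨a', ha', haa⟩ := hU u' hu' a ha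
          exact ⟨a', ha', R.down hab haa le_rfl⟩ }
  coassoc A := hom_ext fun u W => by
    constructor
    · rintro ⟨U, hU, h⟩
      refine ⟨({u} : Finset (bangObj A)), fun v hv => ?_, fun V hV v hv =>
        ⟨u, Finset.mem_singleton_self u, ?_⟩⟩
      · obtain rfl := Finset.mem_singleton.1 hv
        exact le_rfl
      · obtain ⟨u', hu', hVu⟩ := h V hV
        exact (hVu v hv).trans (hU u' hu')
    · rintro ⟨U, hU, h⟩
      refine ⟨({u} : Finset (bangObj A)), fun v hv => ?_, fun V hV =>
        ⟨u, Finset.mem_singleton_self u, fun v hv => ?_⟩⟩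
      · obtain rfl := Finset.mem_singleton.1 hv
        exact le_rfl
      · obtain ⟨u', hu', hVu⟩ := h V hV v hv
        exact hVu.trans (hU u' hu')
  left_counit A := hom_ext fun u v => by
    constructor
    · rintro ⟨U, hU, v', hv', h⟩
      exact h.trans (hU v' hv')
    · intro h
      refine ⟨({u} : Finset (bangObj A)), fun w hw => ?_, u, Finset.mem_singleton_self u, h⟩
      obtain rfl := Finset.mem_singleton.1 hw
      exact le_rfl
  right_counit A := hom_ext fun u v => by
    constructor
    · rintro ⟨U, hU, h⟩ a ha
      obtain ⟨v', hv', a', ha', haa⟩ := h a ha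
      obtain ⟨a1, ha1, h1⟩ := hU v' hv' a' ha'
      exact ⟨a1, ha1, haa.trans h1⟩
    · intro h
      refine ⟨({u} : Finset (bangObj A)), fun w hw => ?_, fun a ha =>
        ⟨u, Finset.mem_singleton_self u, h a ha⟩⟩
      obtain rfl := Finset.mem_singleton.1 hw
      exact le_rfl

/-! ### The colouring comonad, for a finite chain of colours with neutral (least) colour `⊥` -/

/-- `□A`: one copy of `A` for each colour. -/
def boxObj (C : Type) [Finite C] (A : FinScottL) : FinScottL :=
  ofRel (C × A) (fun x y => x.1 = y.1 ∧ x.2 ≤ y.2)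
    (fun _ => ⟨rfl, le_rfl⟩)
    (fun _ _ _ h k => ⟨h.1.trans k.1, h.2.trans k.2⟩)

section Colours

variable (C : Type) [Finite C] [LinearOrder C] [OrderBot C]

/-- The action of `□` on morphisms. -/
def boxMap {A B : FinScottL} (R : A ⟶ B) : boxObj C A ⟶ boxObj C B where
  rel (x : C × A) (y : C × B) := x.1 = y.1 ∧ R.rel x.2 y.2
  down := fun h h1 h2 => ⟨h1.1.symm.trans (h.1.trans h2.1.symm), R.down h.2 h1.2 h2.2⟩

/-- The counit `□A ⟶ A`. -/
def boxDer (A : FinScottL) : boxObj C A ⟶ A where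
  rel (x : C × A) a := x.1 = ⊥ ∧ a ≤ x.2
  down := fun h h1 h2 => ⟨h1.1.symm.trans h.1, h2.trans (h.2.trans h1.2)⟩

/-- The comultiplication `□A ⟶ □□A`. -/
def boxDig (A : FinScottL) : boxObj C A ⟶ boxObj C (boxObj C A) where
  rel (x : C × A) (y : C × (C × A)) := x.1 = max y.1 y.2.1 ∧ y.2.2 ≤ x.2
  down := by
    rintro ⟨c, a⟩ ⟨c', a'⟩ ⟨d, e, b⟩ ⟨d', e', b'⟩ ⟨h, k⟩ ⟨h1, k1⟩ ⟨h2, h3, k3⟩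
    dsimp only at *
    subst h1 h2 h3
    exact ⟨h, k3.trans (k.trans k1)⟩

/-- The comonad `□`. -/
def box : Comonad FinScottL where
  obj := boxObj C
  map := boxMap C
  map_id A := hom_ext fun x y => ⟨fun h => ⟨h.1.symm, h.2⟩, fun h => ⟨h.1.symm, h.2⟩⟩
  map_comp R S := hom_ext fun x z =>
    ⟨fun ⟨h, b, hR, hS⟩ => ⟨(x.1, b), ⟨rfl, hR⟩, h, hS⟩,
     fun ⟨y, ⟨h, hR⟩, k, hS⟩ => ⟨h.trans k, y.2, hR, hS⟩⟩
  ε :=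
    { app := boxDer C
      naturality := fun A B R => hom_ext fun x b =>
        ⟨fun ⟨_, ⟨h, hR⟩, k, hb⟩ => ⟨x.2, ⟨h.trans k, le_rfl⟩, R.down hR le_rfl hb⟩,
         fun ⟨a, ⟨h, ha⟩, hR⟩ => ⟨(x.1, b), ⟨rfl, R.down hR ha le_rfl⟩, h, le_rfl⟩⟩ }
  δ :=
    { app := boxDig C
      naturality := fun A B R => hom_ext fun x y =>
        ⟨fun ⟨_, ⟨h, hR⟩, k, hb⟩ => ⟨(y.1, y.2.1, x.2), ⟨h.trans k, le_rfl⟩, rfl, rfl,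
            R.down hR le_rfl hb⟩,
         fun ⟨_, ⟨h, ha⟩, k, l, hR⟩ => ⟨(x.1, y.2.2), ⟨rfl, R.down hR ha le_rfl⟩,
            by rw [h, k, l], le_rfl⟩⟩ }
  coassoc A := hom_ext fun x y => by
    obtain ⟨c, a⟩ := x
    obtain ⟨c1, c2, c3, b⟩ := y
    constructor
    · rintro ⟨⟨d, e, f⟩, ⟨h, ha⟩, k, l, hb⟩
      dsimp only at *
      subst h k l
      exact ⟨(max d c2, c3, a), ⟨(max_assoc _ _ _).symm, le_rfl⟩, rfl, rfl, hb.trans ha⟩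
    · rintro ⟨⟨d, e, f⟩, ⟨h, ha⟩, k, l, hb⟩
      dsimp only at *
      subst h k l
      exact ⟨(c1, max c2 c3, a), ⟨max_assoc _ _ _, le_rfl⟩, rfl, rfl, hb.trans ha⟩
  left_counit A := hom_ext fun x y => by
    obtain ⟨c, a⟩ := x
    obtain ⟨d, b⟩ := y
    constructor
    · rintro ⟨⟨e, f, g⟩, ⟨h, ha⟩, k, l, hb⟩
      dsimp only at *
      subst k l
      exact ⟨by simp [h], hb.trans ha⟩
    · rintro ⟨h, hb⟩
      dsimp only at *
      subst h
      exact ⟨(⊥, d, a), ⟨by simp, le_rfl⟩, rfl, rfl, hb⟩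
  right_counit A := hom_ext fun x y => by
    obtain ⟨c, a⟩ := x
    obtain ⟨d, b⟩ := y
    constructor
    · rintro ⟨⟨e, f, g⟩, ⟨h, ha⟩, k, l, hb⟩
      dsimp only at *
      subst k l
      exact ⟨by simp [h], hb.trans ha⟩
    · rintro ⟨h, hb⟩
      dsimp only at *
      subst h
      exact ⟨(d, ⊥, a), ⟨by simp, le_rfl⟩, rfl, rfl, hb⟩

/-- The distributive law `λ : !□ ⟶ □!`. -/
def dist : (box C).toFunctor ⋙ bang.toFunctor ⟶ bang.toFunctor ⋙ (box C).toFunctor where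
  app A :=
    { rel := fun (u : Finset (C × A)) (y : C × Finset A) =>
        ∀ a ∈ y.2, ∃ x ∈ u, y.1 = x.1 ∧ a ≤ x.2
      down := by
        rintro u u' ⟨c, v⟩ ⟨c', v'⟩ h hu ⟨hc, hv⟩ a ha
        obtain ⟨a1, ha1, haa⟩ := hv a ha
        obtain ⟨x, hx, hcx, hax⟩ := h a1 ha1
        obtain ⟨x', hx', hcx', hax'⟩ := hu x hx
        exact ⟨x', hx', hc.trans (hcx.trans hcx'), haa.trans (hax.trans hax')⟩ }
  naturality A B R := hom_ext fun u y => by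
    constructor
    · rintro ⟨v, h, k⟩
      obtain ⟨w, hw⟩ := exists_finset fun a : A => ∃ x ∈ (show Finset (C × A) from u), y.1 = x.1 ∧ a ≤ x.2
      refine ⟨(y.1, w), fun a ha => (hw a).1 ha, rfl, fun b hb => ?_⟩
      obtain ⟨z, hz, hyz, hbz⟩ := k b hb
      obtain ⟨x, hx, hxz, hR⟩ := h z hz
      exact ⟨x.2, (hw _).2 ⟨x, hx, hyz.trans hxz.symm, le_rfl⟩, R.down hR le_rfl hbz⟩
    · rintro ⟨w, h, hwy, k⟩
      obtain ⟨v, hv⟩ := exists_finset fun z : C × B => ∃ x ∈ (show Finset (C × A) from u),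
        x.1 = z.1 ∧ R.rel x.2 z.2
      refine ⟨v, fun z hz => (hv z).1 hz, fun b hb => ?_⟩
      obtain ⟨a, ha, hR⟩ := k b hb
      obtain ⟨x, hx, hwx, hax⟩ := h a ha
      exact ⟨(y.1, b), (hv _).2 ⟨x, hx, hwx.symm.trans hwy, R.down hR hax le_rfl⟩, rfl, le_rfl⟩

/-- The object part of the coloured exponential `!□`. -/
abbrev cbObj (A : FinScottL) : FinScottL := bangObj (boxObj C A)

/-- The counit `!□A ⟶ □A ⟶ A` of the coloured exponential. -/
def cbDer (A : FinScottL) : cbObj C A ⟶ A := bangDer (boxObj C A) ≫ boxDer C A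

/-- The comultiplication `!□A ⟶ !!□A ⟶ !!□□A ⟶ !□!□A` of the coloured exponential. -/
def cbDig (A : FinScottL) : cbObj C A ⟶ cbObj C (cbObj C A) :=
  bangDig (boxObj C A) ≫ bangMap (bangMap (boxDig C A)) ≫ bangMap ((dist C).app (boxObj C A))

theorem cbDer_rel {A : FinScottL} {u : Finset (C × A)} {a : A} :
    (cbDer C A).rel u a ↔ ∃ a', (⊥, a') ∈ u ∧ a ≤ a' := by
  constructor
  · rintro ⟨⟨c, b⟩, ⟨⟨d, e⟩, hx, h, h'⟩, k, k'⟩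
    dsimp only at *
    subst h k
    exact ⟨e, hx, k'.trans h'⟩
  · rintro ⟨a', h, k⟩
    exact ⟨(⊥, a'), ⟨_, h, le_rfl⟩, rfl, k⟩

theorem cbDig_rel {A : FinScottL} {u : Finset (C × A)} {V : Finset (C × Finset (C × A))} :
    (cbDig C A).rel u V ↔
      ∀ y ∈ V, ∀ z ∈ y.2, ∃ a', (max y.1 z.1, a') ∈ u ∧ z.2 ≤ a' := by
  constructor
  · rintro ⟨U, hU, W, hW, hV⟩ y hy z hz
    obtain ⟨w, hw, h⟩ := hV y hy
    obtain ⟨x, hx, hxy, hzx⟩ := h z hz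
    obtain ⟨t, ht, h2⟩ := hW w hw
    obtain ⟨s, hs, h3, h4⟩ := h2 x hx
    obtain ⟨r, hr, h5, h6⟩ := hU t ht s hs
    refine ⟨r.2, ?_, hzx.2.trans (h4.trans h6)⟩
    rw [hxy, hzx.1, ← h3, h5]
    exact hr
  · intro h
    obtain ⟨w, hw⟩ := exists_finset fun x : C × (C × A) =>
      ∃ a', (max x.1 x.2.1, a') ∈ u ∧ x.2.2 ≤ a'
    refine ⟨({u} : Finset (bangObj (boxObj C A))), fun v hv => ?_,
      ({w} : Finset (bangObj (boxObj C (boxObj C A)))), fun v hv => ?_, fun y hy => ?_⟩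
    · obtain rfl := Finset.mem_singleton.1 hv
      exact le_rfl
    · obtain rfl := Finset.mem_singleton.1 hv
      refine ⟨u, Finset.mem_singleton_self u, fun x hx => ?_⟩
      obtain ⟨a', ha', h'⟩ := (hw x).1 hx
      exact ⟨_, ha', rfl, h'⟩
    · refine ⟨w, Finset.mem_singleton_self w, fun z hz => ?_⟩
      exact ⟨(y.1, z), (hw _).2 (h y hy z hz), rfl, le_rfl⟩

/-- The coloured exponential comonad `!□`; a morphism `A ⟶ B` of its Kleisli category
`CategoryTheory.Cokleisli (cb C)` is a morphism `!□A ⟶ B` of `FinScottL`. -/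
def cb : Comonad FinScottL where
  toFunctor := (box C).toFunctor ⋙ bang.toFunctor
  ε :=
    { app := cbDer C
      naturality := fun A B R => hom_ext fun u b => by
        constructor
        · rintro ⟨v, h, k⟩
          obtain ⟨b', hb', hbb⟩ := (cbDer_rel C).1 k
          obtain ⟨x, hx, hxb, hR⟩ := h _ hb'
          refine ⟨x.2, (cbDer_rel C).2 ⟨x.2, ?_, le_rfl⟩, R.down hR le_rfl hbb⟩
          rw [← (show x.1 = ⊥ from hxb)]
          exact hx
        · rintro ⟨a, h, hR⟩
          obtain ⟨a', ha', haa⟩ := (cbDer_rel C).1 h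
          refine ⟨({(⊥, b)} : Finset (C × B)), fun y hy => ?_,
            (cbDer_rel C).2 ⟨b, Finset.mem_singleton_self _, le_rfl⟩⟩
          obtain rfl := Finset.mem_singleton.1 hy
          exact ⟨_, ha', rfl, R.down hR haa le_rfl⟩ }
  δ :=
    { app := cbDig C
      naturality := fun A B R => hom_ext fun u V => by
        constructor
        · rintro ⟨v, h, k⟩
          have k := (cbDig_rel C).1 k
          obtain ⟨U, hU⟩ := exists_finset fun y : C × Finset (C × A) =>
            ∀ z ∈ y.2, ∃ a', (max y.1 z.1, a') ∈ (show Finset (C × A) from u) ∧ z.2 ≤ a'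
          refine ⟨U, (cbDig_rel C).2 fun y hy => (hU y).1 hy, fun y hy => ?_⟩
          obtain ⟨w, hw⟩ := exists_finset fun z : C × A =>
            ∃ a', (max y.1 z.1, a') ∈ (show Finset (C × A) from u) ∧ z.2 ≤ a'
          refine ⟨(y.1, w), (hU _).2 fun z hz => (hw z).1 hz, rfl, fun b hb => ?_⟩
          obtain ⟨b', hb', hbb⟩ := k y hy b hb
          obtain ⟨x, hx, hxb, hR⟩ := h _ hb'
          refine ⟨(b.1, x.2), (hw _).2 ⟨x.2, ?_, le_rfl⟩, rfl, R.down hR le_rfl hbb⟩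
          rw [← (show x.1 = max y.1 b.1 from hxb)]
          exact hx
        · rintro ⟨U, k, h⟩
          have k := (cbDig_rel C).1 k
          obtain ⟨v, hv⟩ := exists_finset fun z : C × B =>
            ∃ x ∈ (show Finset (C × A) from u), x.1 = z.1 ∧ R.rel x.2 z.2
          refine ⟨v, fun z hz => (hv z).1 hz, (cbDig_rel C).2 fun y hy z hz =>
            ⟨z.2, (hv _).2 ?_, le_rfl⟩⟩
          obtain ⟨y', hy', hyy, h'⟩ := h y hy
          obtain ⟨x, hx, hxz, hR⟩ := h' z hz
          obtain ⟨a', ha', haa⟩ := k y' hy' x hx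
          refine ⟨_, ha', ?_, R.down hR haa le_rfl⟩
          rw [show y'.1 = y.1 from hyy, show x.1 = z.1 from hxz] }
  coassoc A := hom_ext fun u W => by
    obtain ⟨U, hU⟩ := exists_finset fun y : C × Finset (C × A) =>
      ∀ z ∈ y.2, ∃ a', (max y.1 z.1, a') ∈ (show Finset (C × A) from u) ∧ z.2 ≤ a'
    constructor
    · rintro ⟨U', hU', h⟩
      have hU' := (cbDig_rel C).1 hU'
      refine ⟨U, (cbDig_rel C).2 fun y hy => (hU y).1 hy, (cbDig_rel C).2 fun Y hY y hy =>
        ⟨y.2, (hU _).2 fun z hz => ?_, le_rfl⟩⟩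
      obtain ⟨t, ht, htY, h'⟩ := h Y hY
      obtain ⟨a, ha, haa⟩ := (cbDig_rel C).1 h' y hy z hz
      obtain ⟨a', ha', haa'⟩ := hU' t ht _ ha
      refine ⟨a', ?_, haa.trans haa'⟩
      dsimp only
      rw [← (show t.1 = Y.1 from htY), max_assoc]
      exact ha'
    · rintro ⟨U', hU', h⟩
      have hU' := (cbDig_rel C).1 hU'
      have h := (cbDig_rel C).1 h
      refine ⟨U, (cbDig_rel C).2 fun y hy => (hU y).1 hy, fun Y hY => ?_⟩
      obtain ⟨v, hv⟩ := exists_finset fun z : C × A =>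
        ∃ a', (max Y.1 z.1, a') ∈ (show Finset (C × A) from u) ∧ z.2 ≤ a'
      refine ⟨(Y.1, v), (hU _).2 fun z hz => (hv z).1 hz, rfl, (cbDig_rel C).2 fun y hy z hz =>
        ⟨z.2, (hv _).2 ?_, le_rfl⟩⟩
      obtain ⟨w, hw, hyw⟩ := h Y hY y hy
      obtain ⟨z', hz', hzz, hzz'⟩ := hyw z hz
      obtain ⟨a', ha', haa⟩ := hU' _ hw z' hz'
      refine ⟨a', ?_, hzz'.trans haa⟩
      dsimp only
      rw [show z.1 = z'.1 from hzz, ← max_assoc]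
      exact ha'
  left_counit A := hom_ext fun u v => by
    constructor
    · rintro ⟨U, hU, h⟩
      have hU := (cbDig_rel C).1 hU
      obtain ⟨v', hv', hvv⟩ := (cbDer_rel C).1 h
      intro z hz
      obtain ⟨z', hz', hzz, hzz'⟩ := hvv z hz
      obtain ⟨a', ha', haa⟩ := hU _ hv' z' hz'
      exact ⟨_, ha', by simp [show z.1 = z'.1 from hzz], hzz'.trans haa⟩
    · intro h
      refine ⟨({(⊥, v)} : Finset (C × Finset (C × A))), (cbDig_rel C).2 fun y hy z hz => ?_,
        (cbDer_rel C).2 ⟨v, Finset.mem_singleton_self _, le_rfl⟩⟩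
      obtain rfl := Finset.mem_singleton.1 hy
      obtain ⟨x, hx, h1, h2⟩ := h z hz
      refine ⟨x.2, ?_, h2⟩
      rw [max_eq_right bot_le, show z.1 = x.1 from h1]
      exact hx
  right_counit A := hom_ext fun u v => by
    constructor
    · rintro ⟨U, hU, h⟩ z hz
      have hU := (cbDig_rel C).1 hU
      obtain ⟨y, hy, hyz, h'⟩ := h z hz
      obtain ⟨a, ha, haa⟩ := (cbDer_rel C).1 h'
      obtain ⟨a', ha', haa'⟩ := hU y hy _ ha
      exact ⟨_, ha', by simp [show y.1 = z.1 from hyz], haa.trans haa'⟩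
    · intro h
      obtain ⟨U, hU⟩ := exists_finset fun y : C × Finset (C × A) =>
        ∀ z ∈ y.2, ∃ a', (max y.1 z.1, a') ∈ (show Finset (C × A) from u) ∧ z.2 ≤ a'
      refine ⟨U, (cbDig_rel C).2 fun y hy => (hU y).1 hy, fun z hz => ?_⟩
      obtain ⟨x, hx, h1, h2⟩ := h z hz
      refine ⟨(z.1, ({(⊥, z.2)} : Finset (C × A))), (hU _).2 fun t ht => ?_, rfl,
        (cbDer_rel C).2 ⟨z.2, Finset.mem_singleton_self _, le_rfl⟩⟩
      obtain rfl := Finset.mem_singleton.1 ht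
      refine ⟨x.2, ?_, h2⟩
      dsimp only
      rw [max_eq_left bot_le, show z.1 = x.1 from h1]
      exact hx

end Colours

end FinScottL

/-! ### Labelled trees -/

/-- A possibly infinite, finitely branching tree with nodes labelled in `L`. Nodes are finite
sequences of natural numbers, the root is `[]`, the children of `p` are the nodes `p ++ [i]`.
The values of `label` outside `nodes` are irrelevant. -/
structure LTree (L : Type) where
  nodes : Set (List ℕ)
  root_mem : [] ∈ nodes
  parent_mem : ∀ p i, p ++ [i] ∈ nodes → p ∈ nodes
  finite_children : ∀ p, {i | p ++ [i] ∈ nodes}.Finite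
  label : List ℕ → L

namespace LTree

variable {L : Type} (t : LTree L)

/-- The prefix of length `n` of an infinite sequence of directions. -/
def pref (b : ℕ → ℕ) (n : ℕ) : List ℕ := (List.range n).map b

/-- `b` is an infinite branch of `t`. -/
def IsBranch (b : ℕ → ℕ) : Prop := ∀ n, pref b n ∈ t.nodes

/-- `l` is the label of a child of the node `p`. -/
def ChildLabel (p : List ℕ) (l : L) : Prop := ∃ i, p ++ [i] ∈ t.nodes ∧ t.label (p ++ [i]) = l

end LTree

/-! ### Simple types, higher-order recursion schemes and value trees -/

/-- A ranked alphabet. -/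
structure Sig where
  sym : Type
  ar : sym → ℕ

/-- Simple types over the ground type `o`. -/
inductive Ty where
  | o : Ty
  | arr : Ty → Ty → Ty

/-- The type `o → ⋯ → o → o` of a symbol of arity `n`. -/
def Ty.first : ℕ → Ty
  | 0 => .o
  | n + 1 => .arr .o (Ty.first n)

/-- Variables (de Bruijn indices) of type `σ` in a context. -/
inductive Var : List Ty → Ty → Type
  | zero {Γ : List Ty} {σ : Ty} : Var (σ :: Γ) σ
  | succ {Γ : List Ty} {σ τ : Ty} : Var Γ σ → Var (τ :: Γ) σ

/-- Simply-typed terms without abstraction, built from the symbols of the alphabet,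
the non-terminals and the variables of a context. -/
inductive Term (S : Sig) {N : Type} (ty : N → Ty) (Γ : List Ty) : Ty → Type
  | const (a : S.sym) : Term S ty Γ (Ty.first (S.ar a))
  | nt (F : N) : Term S ty Γ (ty F)
  | var {σ : Ty} (x : Var Γ σ) : Term S ty Γ σ
  | app {σ τ : Ty} (M : Term S ty Γ (.arr σ τ)) (M' : Term S ty Γ σ) : Term S ty Γ τ

/-- Right-hand sides `λx₁. … λxₙ. t`, where `t` has ground type and no abstraction. -/
inductive Rule (S : Sig) {N : Type} (ty : N → Ty) : List Ty → Ty → Type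
  | body {Γ : List Ty} (t : Term S ty Γ .o) : Rule S ty Γ .o
  | lam {Γ : List Ty} {σ τ : Ty} (r : Rule S ty (σ :: Γ) τ) : Rule S ty Γ (.arr σ τ)

/-- A higher-order recursion scheme. -/
structure HORS (S : Sig) where
  N : Type
  [finN : Finite N]
  ty : N → Ty
  start : N
  start_ty : ty start = .o
  rule : ∀ F, Rule S ty [] (ty F)

attribute [instance] HORS.finN

section Rewriting

variable {S : Sig} {N : Type} {ty : N → Ty}

/-- Closed terms for the variables of a context. -/
abbrev Env (S : Sig) {N : Type} (ty : N → Ty) (Γ : List Ty) : Type :=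
  ∀ σ, Var Γ σ → Term S ty [] σ

/-- Extension of an environment by one more term. -/
def Env.cons {Γ : List Ty} {τ : Ty} (t : Term S ty [] τ) (ρ : Env S ty Γ) : Env S ty (τ :: Γ)
  | _, .zero => t
  | _, .succ x => ρ _ x

/-- The empty environment. -/
def Env.nil : Env S ty [] := fun _ x => nomatch x

/-- Simultaneous substitution of closed terms. -/
def Term.subst {Γ : List Ty} (ρ : Env S ty Γ) : ∀ {σ : Ty}, Term S ty Γ σ → Term S ty [] σ
  | _, .const a => .const a
  | _, .nt F => .nt F
  | _, .var x => ρ _ x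
  | _, .app M M' => .app (M.subst ρ) (M'.subst ρ)

/-- Sequences of closed arguments that bring a term of the given type to ground type. -/
inductive Args (S : Sig) {N : Type} (ty : N → Ty) : Ty → Type
  | nil : Args S ty .o
  | cons {σ τ : Ty} (t : Term S ty [] σ) (as : Args S ty τ) : Args S ty (.arr σ τ)

/-- The term `M t₁ … tₙ`. -/
def Args.apply : ∀ {σ : Ty}, Term S ty [] σ → Args S ty σ → Term S ty [] .o
  | _, M, .nil => M
  | _, M, .cons t as => as.apply (.app M t)

/-- The term `t[xᵢ ← tᵢ]`, for a right-hand side `λx₁. … λxₙ. t`. -/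
def Rule.inst : ∀ {Γ : List Ty} {σ : Ty}, Rule S ty Γ σ → Env S ty Γ → Args S ty σ →
    Term S ty [] .o
  | _, _, .body t, ρ, .nil => t.subst ρ
  | _, _, .lam r, ρ, .cons t as => r.inst (Env.cons t ρ) as

/-- The term `M t₁ … tₙ` for `M` of type `o → ⋯ → o → o`. -/
def Term.appN : ∀ {n : ℕ}, Term S ty [] (Ty.first n) → (Fin n → Term S ty [] .o) →
    Term S ty [] .o
  | 0, M, _ => M
  | _ + 1, M, ts => Term.appN (.app M (ts 0)) fun i => ts i.succ

/-- `LabelAt t p a`: the position `p` of the term `t` is reached through symbols of the alphabet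
only, and carries the symbol `a`. -/
inductive LabelAt : Term S ty [] .o → List ℕ → S.sym → Prop
  | root (a : S.sym) (ts : Fin (S.ar a) → Term S ty [] .o) :
      LabelAt (Term.appN (.const a) ts) [] a
  | child (a : S.sym) (ts : Fin (S.ar a) → Term S ty [] .o) (i : Fin (S.ar a)) (p : List ℕ)
      (b : S.sym) (h : LabelAt (ts i) p b) : LabelAt (Term.appN (.const a) ts) (i.val :: p) b

end Rewriting

namespace HORS

variable {S : Sig} (G : HORS S)

/-- The rewriting relation: `F t₁ … tₙ ⟶ t[xᵢ ← tᵢ]`, at any place of a term. -/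
inductive Step : ∀ {σ : Ty}, Term S G.ty [] σ → Term S G.ty [] σ → Prop
  | rule (F : G.N) (as : Args S G.ty (G.ty F)) :
      Step (as.apply (.nt F)) ((G.rule F).inst Env.nil as)
  | left {σ τ : Ty} {M M' : Term S G.ty [] (.arr σ τ)} (P : Term S G.ty [] σ) (h : Step M M') :
      Step (.app M P) (.app M' P)
  | right {σ τ : Ty} (M : Term S G.ty [] (.arr σ τ)) {P P' : Term S G.ty [] σ} (h : Step P P') :
      Step (.app M P) (.app M P')

/-- The start symbol, as a closed term of ground type. -/
def startTerm : Term S G.ty [] .o := G.start_ty ▸ Term.nt G.start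

/-- The value tree, as the graph of a partial function from positions to symbols: the position `p`
carries `a` when it does so in some term obtained from the start symbol. -/
def valueTree (p : List ℕ) (a : S.sym) : Prop :=
  ∃ t, Relation.ReflTransGen G.Step G.startTerm t ∧ LabelAt t p a

end HORS

/-! ### Alternating parity tree automata -/

/-- An alternating parity tree automaton. The formula `δ(q, a)` is a finite disjunction of
conjunctive clauses, each of them a finite set of pairs (direction, state). -/
structure APT (S : Sig) where
  Q : Type
  [finQ : Finite Q]
  δ : Q → (a : S.sym) → Finset (Finset (Fin (S.ar a) × Q))
  Ω : Q → ℕ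

namespace APT

attribute [instance] APT.finQ

variable {S : Sig} (A : APT S)

/-- `r` is a run-tree of the automaton with initial state `q₀` over the tree `T`. A node of `r`
is labelled by the position of `T` that it visits and by the state in which it does so; the visited
position has to carry a symbol. -/
structure IsRun (T : List ℕ → S.sym → Prop) (q₀ : A.Q) (r : LTree (List ℕ × A.Q)) : Prop where
  root : r.label [] = ([], q₀)
  step : ∀ p ∈ r.nodes, ∃ a, T (r.label p).1 a ∧ ∃ φ ∈ A.δ (r.label p).2 a,
    ∀ l, r.ChildLabel p l ↔ ∃ d q, (d, q) ∈ φ ∧ l = ((r.label p).1 ++ [d.val], q)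

/-- The greatest number that occurs infinitely often in the sequence exists and is even. -/
def ParityWin (s : ℕ → ℕ) : Prop :=
  ∃ c, IsGreatest {d | ∃ᶠ n in Filter.atTop, s n = d} c ∧ Even c

/-- There is an accepting run-tree with initial state `q₀` over `T`. -/
def Accepts (T : List ℕ → S.sym → Prop) (q₀ : A.Q) : Prop :=
  ∃ r, A.IsRun T q₀ r ∧
    ∀ b, r.IsBranch b → ParityWin fun n => A.Ω (r.label (LTree.pref b n)).2

/-- The colours `Ω(Q) ⊎ {ε}`; the neutral colour `ε` is `⊥`. -/
abbrev Col : Type := WithBot (Set.range A.Ω)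

instance : Finite A.Col := inferInstanceAs (Finite (Option (Set.range A.Ω)))

/-- The colour of a state. -/
def col (q : A.Q) : A.Col := ((⟨A.Ω q, q, rfl⟩ : Set.range A.Ω) : WithBot (Set.range A.Ω))

/-- The tuple `α` satisfies the formula `δ(q, a)`. -/
def Sat (q : A.Q) (a : S.sym) (α : Fin (S.ar a) → Finset (A.Col × A.Q)) : Prop :=
  ∃ φ ∈ A.δ q a, ∀ k q', (k, q') ∈ φ → (A.col q', q') ∈ α k

/-! ### The finitary coloured Scott model -/

open FinScottL

/-- The coloured exponential `!□X`. -/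
abbrev Bang (X : FinScottL) : FinScottL := cbObj A.Col X

/-- Morphisms `X ⟶ Y` of the Kleisli category of the coloured exponential. -/
abbrev KHom (X Y : FinScottL) : Type := Bang A X ⟶ Y

/-- The promotion `!□X ⟶ !□!□X ⟶ !□Y` of a Kleisli morphism. -/
def promote {X Y : FinScottL} (R : A.KHom X Y) : Bang A X ⟶ Bang A Y :=
  (cb A.Col).δ.app X ≫ (cb A.Col).map R

/-- The interpretation of simple types. -/
def den : Ty → FinScottL
  | .o => discrete A.Q
  | .arr σ τ => lolli (Bang A (den σ)) (den τ)

/-- The Seely isomorphism: `!□X ⊗ !□Y ≅ !□(X & Y)`. -/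
def seely {X Y : FinScottL} (u : Finset (A.Col × X)) (v : Finset (A.Col × Y)) :
    Finset (A.Col × (X ⊕ Y)) :=
  (u.disjSum v).map (Equiv.prodSumDistrib A.Col X Y).symm.toEmbedding

theorem mem_seely_inl {X Y : FinScottL} {u : Finset (A.Col × X)} {v : Finset (A.Col × Y)}
    {c : A.Col} {x : X} : (c, Sum.inl x) ∈ A.seely u v ↔ (c, x) ∈ u := by
  simp [seely, Finset.mem_map_equiv]

theorem mem_seely_inr {X Y : FinScottL} {u : Finset (A.Col × X)} {v : Finset (A.Col × Y)}
    {c : A.Col} {y : Y} : (c, Sum.inr y) ∈ A.seely u v ↔ (c, y) ∈ v := by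
  simp [seely, Finset.mem_map_equiv]

/-- Currying in the Kleisli category. -/
def curry {X Y Z : FinScottL} (R : A.KHom (prod X Y) Z) : A.KHom Y (lolli (Bang A X) Z) where
  rel (w : Finset (A.Col × Y)) (x : Finset (A.Col × X) × Z) := R.rel (A.seely x.1 w) x.2
  down := by
    rintro w w' ⟨u, z⟩ ⟨u', z'⟩ h hw ⟨hu, hz⟩
    refine R.down h ?_ hz
    rintro ⟨c, x | y⟩ hm
    · obtain ⟨⟨d, x'⟩, h1, h2, h3⟩ := hu (c, x) (A.mem_seely_inl.1 hm)
      exact ⟨(d, Sum.inl x'), A.mem_seely_inl.2 h1, h2, Sum.LiftRel.inl h3⟩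
    · obtain ⟨⟨d, y'⟩, h1, h2, h3⟩ := hw (c, y) (A.mem_seely_inr.1 hm)
      exact ⟨(d, Sum.inr y'), A.mem_seely_inr.2 h1, h2, Sum.LiftRel.inr h3⟩

/-- Application in the Kleisli category: evaluation after `R` and the promotion of `T`, both
applied to the same context. -/
def apply {X Y Z : FinScottL} (R : A.KHom X (lolli (Bang A Y) Z)) (T : A.KHom X Y) :
    A.KHom X Z where
  rel w z := ∃ v : Bang A Y, R.rel w (v, z) ∧ (A.promote T).rel w v
  down := fun ⟨v, h, k⟩ hw hz =>
    ⟨v, R.down h hw ⟨le_rfl, hz⟩, (A.promote T).down k hw le_rfl⟩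

/-- An element `u₁ → ⋯ → uₙ → q` of the interpretation of `o → ⋯ → o → o`, as the tuple of the
`uᵢ` and the state `q`. -/
def spine : ∀ (n : ℕ), A.den (Ty.first n) → (Fin n → Finset (A.Col × A.Q)) × A.Q
  | 0, q => (Fin.elim0, q)
  | n + 1, x => (Fin.cons x.1 (spine n x.2).1, (spine n x.2).2)

theorem spine_le : ∀ (n : ℕ) {x y : A.den (Ty.first n)}, x ≤ y →
    (A.spine n x).2 = (A.spine n y).2 ∧ ∀ k, (A.spine n y).1 k ⊆ (A.spine n x).1 k
  | 0, _, _, h => ⟨h, fun k => k.elim0⟩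
  | n + 1, x, y, h => by
    obtain ⟨h1, h2⟩ := h
    obtain ⟨h3, h4⟩ := spine_le n h2
    refine ⟨h3, Fin.cases ?_ h4⟩
    rintro ⟨c, q⟩ hm
    obtain ⟨⟨d, q'⟩, hm', hc, hq⟩ := h1 (c, q) hm
    obtain rfl : c = d := hc
    obtain rfl : q = q' := hq
    exact hm'

/-- The interpretation of the symbol `a`, in any context. -/
def constDen (X : FinScottL) (a : S.sym) : A.KHom X (A.den (Ty.first (S.ar a))) where
  rel _ x := A.Sat (A.spine _ x).2 a (A.spine _ x).1
  down := by
    rintro u u' x y ⟨φ, hφ, h⟩ _ hxy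
    obtain ⟨h1, h2⟩ := A.spine_le _ hxy
    exact ⟨φ, h1 ▸ hφ, fun k q' hk => h2 k (h k q' hk)⟩

section Terms

variable {N : Type} [Finite N] (ty : N → Ty)

/-- The product of the interpretations of the non-terminals. -/
def denNT : FinScottL := pi fun F => A.den (ty F)

/-- The interpretation of a context: the product of its types and of the non-terminals. -/
def denCtx : List Ty → FinScottL
  | [] => A.denNT ty
  | σ :: Γ => prod (A.den σ) (denCtx Γ)

/-- The projection to a variable of the context. -/
def projVar : ∀ {Γ : List Ty} {σ : Ty}, Var Γ σ → (A.denCtx ty Γ ⟶ A.den σ)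
  | _, _, .zero => fst _ _
  | _, _, .succ x => snd _ _ ≫ projVar x

/-- The projection to a non-terminal. -/
def projNT (F : N) : ∀ Γ : List Ty, A.denCtx ty Γ ⟶ A.den (ty F)
  | [] => proj _ F
  | _ :: Γ => snd _ _ ≫ projNT F Γ

/-- The interpretation of terms. -/
def denTerm {Γ : List Ty} : ∀ {σ : Ty}, Term S ty Γ σ → A.KHom (A.denCtx ty Γ) (A.den σ)
  | _, .const a => A.constDen _ a
  | _, .nt F => (cb A.Col).ε.app _ ≫ A.projNT ty F Γ
  | _, .var x => (cb A.Col).ε.app _ ≫ A.projVar ty x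
  | _, .app M M' => A.apply (denTerm M) (denTerm M')

/-- The interpretation of `λx₁. … λxₙ. t`. -/
def denRule : ∀ {Γ : List Ty} {σ : Ty}, Rule S ty Γ σ → A.KHom (A.denCtx ty Γ) (A.den σ)
  | _, _, .body t => A.denTerm ty t
  | _, _, .lam r => A.curry (denRule r)

end Terms

/-! ### The fixpoint operator -/

/-- `w` is a semantic run-tree of `R` producing `a`. A node of `w` is labelled by an element of
`X ⊎ Y` together with a colour. -/
structure IsSemRun {X Y : FinScottL} (R : tensor (Bang A X) (Bang A Y) ⟶ Y) (a : Y)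
    (w : LTree ((X ⊕ Y) × A.Col)) : Prop where
  root : w.label [] = (Sum.inr a, ⊥)
  leaf : ∀ p ∈ w.nodes, ∀ x, (w.label p).1 = Sum.inl x → ∀ i, p ++ [i] ∉ w.nodes
  step : ∀ p ∈ w.nodes, ∀ b, (w.label p).1 = Sum.inr b →
    ∃ (u : Finset (A.Col × X)) (v : Finset (A.Col × Y)),
      (∀ c x, (c, x) ∈ u ↔ w.ChildLabel p (Sum.inl x, c)) ∧
      (∀ c y, (c, y) ∈ v ↔ w.ChildLabel p (Sum.inr y, c)) ∧ R.rel (u, v) b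

/-- The winning condition on a sequence of colours: some non-neutral colour occurs infinitely
often, and the greatest such colour is even. -/
def ColWin (s : ℕ → A.Col) : Prop :=
  ∃ c : Set.range A.Ω,
    IsGreatest {d : Set.range A.Ω | ∃ᶠ n in Filter.atTop, s n = (d : WithBot (Set.range A.Ω))} c ∧
    Even c.val

/-- The semantic run-tree `w` is winning. -/
def SemWinning {X Y : FinScottL} (w : LTree ((X ⊕ Y) × A.Col)) : Prop :=
  ∀ b, w.IsBranch b → A.ColWin fun n => (w.label (LTree.pref b n)).2

/-- `(c, x)` belongs to `leaves(w)`: some node of `w` is labelled by `x`, and `c` is the greatest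
colour on the path between this node and the root, both included. -/
def IsLeaf {X Y : FinScottL} (w : LTree ((X ⊕ Y) × A.Col)) (c : A.Col) (x : X) : Prop :=
  ∃ p ∈ w.nodes, (w.label p).1 = Sum.inl x ∧ IsGreatest {d | ∃ s, s <+: p ∧ (w.label s).2 = d} c

/-- The fixpoint operator, which transports a morphism `!□X ⊗ !□Y ⟶ Y` to a relation between
`!□X` and `Y`. -/
def fixRel {X Y : FinScottL} (R : tensor (Bang A X) (Bang A Y) ⟶ Y)
    (u : Finset (A.Col × X)) (a : Y) : Prop :=
  ∃ w, A.IsSemRun R a w ∧ (∀ c x, (c, x) ∈ u ↔ A.IsLeaf w c x) ∧ A.SemWinning w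

/-! ### The interpretation of a recursion scheme -/

/-- The morphism `!□⊤ ⊗ !□N ⟶ N` given by the right-hand sides of the scheme, where `N` is the
product of the interpretations of the non-terminals. -/
def ruleHom (G : HORS S) :
    tensor (Bang A top) (Bang A (A.denNT G.ty)) ⟶ A.denNT G.ty where
  rel x y := (tuple fun F => A.denRule G.ty (G.rule F)).rel x.2 y
  down := fun h hx hy => (tuple fun F => A.denRule G.ty (G.rule F)).down h hx.2 hy

/-- A state, as an element of the interpretation of the type `o` of the start symbol. -/
def startElt (G : HORS S) (q : A.Q) : A.den (G.ty G.start) :=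
  G.start_ty.symm ▸ (show A.den .o from q)

/-- The interpretation of the scheme: the component at the start symbol of the fixpoint of its
right-hand sides. -/
def interp (G : HORS S) : Set A.Q :=
  {q | A.fixRel (A.ruleHom G) ∅ ⟨G.start, A.startElt G q⟩}

end APT

end HOMC

/-!
Both sides of the equivalence say that a player wins a parity game. An accepting run-tree amounts to
a winning strategy in the acceptance game on the terms of the scheme, where head reduction plays
silent moves and the clauses of the automaton are chosen at the constants; this uses
standardization: head reduction already computes every node of the value tree. The fixpoint `Y` is
by definition a game in which the edges are given by the elements that a right-hand side uses.

From acceptance to the model: fix a winning strategy on terms. An occurrence of a non-terminal in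
head position is described by the element of the model which records for each argument where it
comes to head position later, with the greatest colour on the path to that point, together with the
recursively defined descriptions of these occurrences. These elements form a winning strategy in the
fixpoint game, since every play of it is a play on terms cut into blocks.

From the model to acceptance: derivations in the model guide an abstract machine performing head
reduction, whose plays are the plays of the acceptance game. Suppose that a play has a losing limit
colour `c`. From some point on all colours are at most `c`, and every vertex of the play has a
level: the number of moves until `c` occurs next. A derivation is safe at a level if the machine
running it with safe arguments never is on this play at that level. All derivations for
non-terminals are safe by induction on the vertex of the fixpoint strategy along paths of greatest
colour `c`, which is well-founded because `c` is losing, and on the level along paths of smaller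
colour; so the losing play does not exist.
-/

namespace HOMC

/-! ### Limit colours and coloured graphs -/

open Filter in
/-- `IsLimitColour s c`: the greatest colour that occurs infinitely often in `s` is `c`. -/
def IsLimitColour {C : Type*} [LinearOrder C] (s : ℕ → C) (c : C) : Prop :=
  (∃ᶠ n in atTop, c ≤ s n) ∧ ∀ᶠ n in atTop, s n ≤ c

namespace IsLimitColour

open Filter

variable {C : Type*} [LinearOrder C] {s : ℕ → C} {c : C}

theorem const (c : C) : IsLimitColour (fun _ => c) c :=
  ⟨.of_forall fun _ => le_rfl, .of_forall fun _ => le_rfl⟩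

theorem frequently_eq (h : IsLimitColour s c) : ∃ᶠ n in atTop, s n = c :=
  (h.1.and_eventually h.2).mono fun _ hn => le_antisymm hn.2 hn.1

theorem isGreatest (h : IsLimitColour s c) : IsGreatest {d | ∃ᶠ n in atTop, s n = d} c := by
  refine ⟨h.frequently_eq, fun d hd => ?_⟩
  obtain ⟨n, rfl, hn⟩ := (hd.and_eventually h.2).exists
  exact hn

theorem unique {d : C} (h : IsLimitColour s c) (h' : IsLimitColour s d) : c = d :=
  h.isGreatest.unique h'.isGreatest

theorem exists_of_finite [Finite C] (s : ℕ → C) : ∃ c, IsLimitColour s c := by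
  have hne : {c | ∃ᶠ n in atTop, s n = c}.Nonempty :=
    frequently_exists.1 (Frequently.of_forall fun n => ⟨s n, rfl⟩)
  obtain ⟨c, hc, hmax⟩ := Set.exists_max_image _ id (Set.toFinite _) hne
  refine ⟨c, hc.mono fun _ => ge_of_eq, ?_⟩
  have hne : ∀ᶠ n in atTop, ∀ d, c < d → s n ≠ d :=
    eventually_all.2 fun d => eventually_imp_distrib_left.2 fun hd =>
      not_frequently.1 fun hfreq => (hmax d hfreq).not_gt hd
  exact hne.mono fun n hn => le_of_not_gt fun hlt => hn _ hlt rfl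

theorem iff_isGreatest [Finite C] :
    IsLimitColour s c ↔ IsGreatest {d | ∃ᶠ n in atTop, s n = d} c := by
  refine ⟨isGreatest, fun h => ?_⟩
  obtain ⟨d, hd⟩ := exists_of_finite s
  exact h.unique hd.isGreatest ▸ hd

theorem shift_iff (k : ℕ) : IsLimitColour (fun n => s (n + k)) c ↔ IsLimitColour s c := by
  rw [IsLimitColour, ← frequently_map (m := (· + k)) (P := fun n => c ≤ s n),
    ← eventually_map (m := (· + k)) (P := fun n => s n ≤ c), map_add_atTop_eq_nat]
  exact Iff.rfl

end IsLimitColour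

theorem exists_mem_Ico_of_strictMono {t : ℕ → ℕ} (ht : StrictMono t) {n : ℕ} (hn : t 0 ≤ n) :
    ∃ i, n ∈ Set.Ico (t i) (t (i + 1)) :=
  Set.mem_iUnion.1 ((iUnion_Ico_map_succ_eq_Ici (fun i => ht.monotone i.zero_le)
    (Filter.not_bddAbove_of_tendsto_atTop ht.tendsto_atTop)).ge hn)

theorem eq_of_mem_Ico_of_monotone {t : ℕ → ℕ} (ht : Monotone t) {n i j : ℕ}
    (hi : n ∈ Set.Ico (t i) (t (i + 1))) (hj : n ∈ Set.Ico (t j) (t (j + 1))) : i = j :=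
  by_contra fun hij => Set.disjoint_left.1 (ht.pairwise_disjoint_on_Ico_succ hij) hi hj

open Filter in
theorem frequently_block_iff {C : Type*} [Preorder C] {t : ℕ → ℕ} (ht : StrictMono t)
    {s u : ℕ → C} (h : ∀ i, IsGreatest (s '' Set.Ico (t i) (t (i + 1))) (u i))
    {P : C → Prop} (hP : ∀ c d, c ≤ d → P c → P d) :
    (∃ᶠ i in atTop, P (u i)) ↔ ∃ᶠ n in atTop, P (s n) := by
  simp only [frequently_atTop]
  constructor
  · intro hu N
    obtain ⟨i, hi, hPi⟩ := hu N
    obtain ⟨n, hn, hni⟩ := (h i).1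
    exact ⟨n, hi.trans (ht.le_apply.trans hn.1), hni ▸ hPi⟩
  · intro hs N
    obtain ⟨n, hn, hPn⟩ := hs (t N)
    obtain ⟨i, hi⟩ := exists_mem_Ico_of_strictMono ht ((ht.monotone N.zero_le).trans hn)
    exact ⟨i, Nat.lt_succ_iff.1 (ht.lt_iff_lt.1 (hn.trans_lt hi.2)),
      hP _ _ ((h i).2 ⟨n, hi, rfl⟩) hPn⟩

theorem isLimitColour_block_iff {C : Type*} [LinearOrder C] {t : ℕ → ℕ} (ht : StrictMono t)
    {s u : ℕ → C} (h : ∀ i, IsGreatest (s '' Set.Ico (t i) (t (i + 1))) (u i)) {c : C} :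
    IsLimitColour u c ↔ IsLimitColour s c := by
  refine and_congr (frequently_block_iff ht h fun _ _ => ge_trans) ?_
  simpa only [Filter.not_frequently, not_lt] using
    not_congr (frequently_block_iff ht h (P := (c < ·)) fun _ _ hle hlt => hlt.trans_le hle)

/-- `Path E x c y`: there is a non-empty path from `x` to `y` in the graph `E` with coloured edges,
and the greatest colour on it is `c`. -/
inductive Path {X C : Type*} [LinearOrder C] (E : X → C → X → Prop) : X → C → X → Prop
  | single {x c y} (h : E x c y) : Path E x c y
  | cons {x c y d z} (h : E x c y) (p : Path E y d z) : Path E x (max c d) z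

namespace Path

variable {X C : Type*} [LinearOrder C] {E : X → C → X → Prop}

theorem trans {x c y d z} (p : Path E x c y) (p' : Path E y d z) : Path E x (max c d) z := by
  induction p with
  | single h => exact .cons h p'
  | cons h _ ih => rw [max_assoc]; exact .cons h (ih p')

theorem exists_edges {x c y} (h : Path E x c y) :
    ∃ (l : ℕ) (p : ℕ → X) (e : ℕ → C), p 0 = x ∧ p (l + 1) = y ∧
      (∀ k ≤ l, E (p k) (e k) (p (k + 1))) ∧ IsGreatest (e '' Set.Iic l) c := by
  induction h with
  | @single x c y h =>
    refine ⟨0, fun k => k.casesOn x fun _ => y, fun _ => c, rfl, rfl, ?_, by simp⟩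
    rintro k hk
    obtain rfl := Nat.le_zero.1 hk
    exact h
  | @cons x c y d z h _ ih =>
    obtain ⟨l, p, e, rfl, hl, hE, hd⟩ := ih
    refine ⟨l + 1, fun k => k.casesOn x p, fun k => k.casesOn c e, rfl, hl, ?_, ?_⟩
    · rintro (_ | k) hk
      · exact h
      · exact hE k (Nat.le_of_succ_le_succ hk)
    · constructor
      · rcases max_choice c d with hmax | hmax
        · exact ⟨0, Nat.zero_le _, hmax.symm⟩
        · obtain ⟨k, hk, hkd⟩ := hd.1
          exact ⟨k + 1, Nat.succ_le_succ hk, hkd.trans hmax.symm⟩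
      · rintro _ ⟨_ | k, hk, rfl⟩
        · exact le_max_left _ _
        · exact (hd.2 ⟨k, Nat.le_of_succ_le_succ hk, rfl⟩).trans (le_max_right _ _)

theorem exists_concat {x : ℕ → X} {c : ℕ → C} (h : ∀ n, Path E (x n) (c n) (x (n + 1))) :
    ∃ (y : ℕ → X) (e : ℕ → C) (t : ℕ → ℕ), (∀ n, E (y n) (e n) (y (n + 1))) ∧
      StrictMono t ∧ ∀ i, IsGreatest (e '' Set.Ico (t i) (t (i + 1))) (c i) := by
  choose l p e h0 hl hE hc using fun n => (h n).exists_edges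
  let t (i : ℕ) : ℕ := ∑ j ∈ Finset.range i, (l j + 1)
  have ht_succ (i : ℕ) : t (i + 1) = t i + (l i + 1) := Finset.sum_range_succ _ _
  have ht : StrictMono t := strictMono_nat_of_lt_succ fun i => by rw [ht_succ]; omega
  choose b hb using fun n => exists_mem_Ico_of_strictMono ht (n.zero_le : t 0 ≤ n)
  have hblock {i k : ℕ} (hk : k ≤ l i) : b (t i + k) = i :=
    eq_of_mem_Ico_of_monotone ht.monotone (hb _) ⟨Nat.le_add_right _ _, by rw [ht_succ]; omega⟩
  let y (n : ℕ) : X := p (b n) (n - t (b n))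
  let e' (n : ℕ) : C := e (b n) (n - t (b n))
  have he' {i k : ℕ} (hk : k ≤ l i) : e' (t i + k) = e i k := by simp [e', hblock hk]
  have hy {i k : ℕ} (hk : k ≤ l i) : y (t i + k) = p i k := by simp [y, hblock hk]
  have hy_end (i : ℕ) : y (t i + (l i + 1)) = p i (l i + 1) := by
    rw [← ht_succ, ← Nat.add_zero (t (i + 1)), hy (Nat.zero_le _), h0, hl]
  refine ⟨y, e', t, fun n => ?_, ht, fun i => ?_⟩
  · obtain ⟨k, hk⟩ := Nat.exists_eq_add_of_le (hb n).1
    have hkl : k ≤ l (b n) := by have := (hb n).2; rw [ht_succ] at this; omega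
    have hnext : y (t (b n) + (k + 1)) = p (b n) (k + 1) := by
      rcases hkl.lt_or_eq with hlt | heq
      · exact hy hlt
      · rw [heq, hy_end]
    rw [hk, he' hkl, hy hkl, Nat.add_assoc, hnext]
    exact hE _ _ hkl
  · have himage : e' '' Set.Ico (t i) (t (i + 1)) = e i '' Set.Iic (l i) := by
      ext a
      constructor
      · rintro ⟨n, ⟨hn, hn'⟩, rfl⟩
        obtain ⟨k, rfl⟩ := Nat.exists_eq_add_of_le hn
        have hk : k ≤ l i := by rw [ht_succ] at hn'; omega
        exact ⟨k, hk, (he' hk).symm⟩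
      · rintro ⟨k, hk, rfl⟩
        rw [Set.mem_Iic] at hk
        exact ⟨t i + k, ⟨Nat.le_add_right _ _, by rw [ht_succ]; omega⟩, he' hk⟩
    exact himage ▸ hc i

end Path

/-- `Reach E x c y`: there is a possibly empty path from `x` to `y`, and `c` is the greatest of the
colours on it and the least colour. -/
def Reach {X C : Type*} [LinearOrder C] [OrderBot C] (E : X → C → X → Prop)
    (x : X) (c : C) (y : X) : Prop :=
  (x = y ∧ c = ⊥) ∨ Path E x c y

namespace Reach

variable {X C : Type*} [LinearOrder C] [OrderBot C] {E : X → C → X → Prop}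

theorem refl (x : X) : Reach E x ⊥ x := .inl ⟨rfl, rfl⟩

theorem trans {x c y d z} (h : Reach E x c y) (h' : Reach E y d z) : Reach E x (max c d) z := by
  rcases h with ⟨rfl, rfl⟩ | h
  · rwa [max_bot_left]
  · rcases h' with ⟨rfl, rfl⟩ | h'
    · rw [max_bot_right]
      exact .inr h
    · exact .inr (h.trans h')

theorem cons_bot {x y c z} (h : E x ⊥ y) (h' : Reach E y c z) : Path E x c z := by
  rcases h' with ⟨rfl, rfl⟩ | h'
  · exact .single h
  · exact max_bot_left c ▸ .cons h h'

end Reach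

namespace APT

variable {S : Sig} {A : APT S} {X Y : Type*}

variable (A) in
/-- The winning condition of all parity games below: the limit colour is even and not neutral. -/
def IsWinning (s : ℕ → A.Col) : Prop :=
  ∃ c : Set.range A.Ω, Even c.val ∧ IsLimitColour s (c : WithBot (Set.range A.Ω))

theorem isWinning_iff_const {s : ℕ → A.Col} {c : A.Col} (h : IsLimitColour s c) :
    A.IsWinning s ↔ A.IsWinning fun _ => c :=
  exists_congr fun _ => and_congr_right fun _ =>
    ⟨fun hs => h.unique hs ▸ .const c, fun hc => hc.unique (.const c) ▸ h⟩

theorem isWinning_shift_iff {s : ℕ → A.Col} (k : ℕ) :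
    A.IsWinning (fun n => s (n + k)) ↔ A.IsWinning s := by
  simp only [IsWinning, IsLimitColour.shift_iff]

theorem isWinning_block_iff {t : ℕ → ℕ} (ht : StrictMono t) {s u : ℕ → A.Col}
    (h : ∀ i, IsGreatest (s '' Set.Ico (t i) (t (i + 1))) (u i)) :
    A.IsWinning u ↔ A.IsWinning s := by
  simp only [IsWinning, isLimitColour_block_iff ht h]

theorem not_isWinning_bot : ¬ A.IsWinning fun _ => ⊥ := by
  rintro ⟨c, _, hlim⟩
  exact WithBot.bot_ne_coe ((IsLimitColour.const _).unique hlim)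

theorem colWin_iff {s : ℕ → A.Col} : A.ColWin s ↔ A.IsWinning s := by
  simp only [ColWin, IsWinning, IsLimitColour.iff_isGreatest]
  refine exists_congr fun c => and_comm.trans (and_congr_right fun _ => and_congr_right fun _ => ?_)
  refine ⟨fun h d hd => ?_, fun h d hd => WithBot.coe_le_coe.1 (h hd)⟩
  induction d using WithBot.recBotCoe with
  | bot => exact bot_le
  | coe d => exact WithBot.coe_le_coe.2 (h hd)

theorem col_eq_coe_iff {q : A.Q} {c : Set.range A.Ω} :
    A.col q = (c : WithBot (Set.range A.Ω)) ↔ A.Ω q = c.val :=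
  WithBot.coe_inj.trans Subtype.ext_iff

theorem parityWin_iff {s : ℕ → A.Q} :
    ParityWin (fun n => A.Ω (s n)) ↔ A.IsWinning fun n => A.col (s n) := by
  rw [← colWin_iff]
  simp only [ColWin, ParityWin, col_eq_coe_iff]
  constructor
  · rintro ⟨c, ⟨hc, hmax⟩, heven⟩
    obtain ⟨n, hn⟩ := hc.exists
    exact ⟨⟨c, s n, hn⟩, ⟨hc, fun d hd => hmax hd⟩, heven⟩
  · rintro ⟨c, ⟨hc, hmax⟩, heven⟩
    refine ⟨c, ⟨hc, fun d hd => ?_⟩, heven⟩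
    obtain ⟨n, hn⟩ := hd.exists
    exact hmax (show (⟨d, s n, hn⟩ : Set.range A.Ω) ∈ _ from hd)

variable (A) in
/-- All infinite sequences of edges of the coloured graph `E` are winning. -/
def AllPlaysWin (E : X → A.Col → X → Prop) : Prop :=
  ∀ (x : ℕ → X) (c : ℕ → A.Col), (∀ n, E (x n) (c n) (x (n + 1))) → A.IsWinning c

variable {E : X → A.Col → X → Prop}

theorem AllPlaysWin.path (hE : A.AllPlaysWin E) : A.AllPlaysWin (Path E) := by
  intro x c hx
  obtain ⟨y, e, t, hy, ht, hmax⟩ := Path.exists_concat hx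
  exact (isWinning_block_iff ht hmax).2 (hE y e hy)

theorem AllPlaysWin.wellFounded (hE : A.AllPlaysWin E) {c : A.Col}
    (hc : ¬ A.IsWinning fun _ => c) : WellFounded fun y x => E x c y :=
  wellFounded_iff_isEmpty_descending_chain.2 ⟨fun ⟨x, hx⟩ => hc (hE x _ hx)⟩

open Filter in
/-- Silent moves have to be well-founded, but then they matter neither for the existence of the
visible play nor for the limit colour. -/
theorem AllPlaysWin.of_silent {E' : Y → A.Col → Y → Prop} (hE' : A.AllPlaysWin E') {f : X → Y}
    {silent : X → X → Prop} (hsilent : WellFounded silent)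
    (h : ∀ x c y, E x c y → c = ⊥ ∧ f y = f x ∧ silent y x ∨ E' (f x) c (f y)) :
    A.AllPlaysWin E := by
  intro x c hx
  let V : Set ℕ := {n | E' (f (x n)) (c n) (f (x (n + 1)))}
  have hV_compl : ∀ n ∉ V, c n = ⊥ ∧ f (x (n + 1)) = f (x n) ∧ silent (x (n + 1)) (x n) :=
    fun n hn => (h _ _ _ (hx n)).resolve_right hn
  have hV : V.Infinite := by
    refine Nat.frequently_atTop_iff_infinite.1 fun hfin => ?_
    obtain ⟨N, hN⟩ := eventually_atTop.1 hfin
    refine (wellFounded_iff_isEmpty_descending_chain.1 hsilent).false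
      ⟨fun n => x (N + n), fun n => ?_⟩
    exact (hV_compl _ (hN _ (Nat.le_add_right N n))).2.2
  let t : ℕ → ℕ := Nat.nth (· ∈ V)
  have ht : StrictMono t := Nat.nth_strictMono hV
  have ht_mem : ∀ i, t i ∈ V := Nat.nth_mem_of_infinite hV
  have ht_between : ∀ i n, t i < n → n < t (i + 1) → n ∉ V := fun i n h1 h2 hn =>
    h1.not_ge (Nat.le_nth_of_lt_nth_succ h2 hn)
  have hconst : ∀ i n, t i < n → n ≤ t (i + 1) → f (x n) = f (x (t i + 1)) := by
    intro i n hn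
    induction n, hn using Nat.le_induction with
    | base => exact fun _ => rfl
    | succ n hn ih =>
      exact fun hle => (hV_compl n (ht_between i n hn hle)).2.1.trans (ih (Nat.le_of_lt hle))
  have hmax : ∀ i, IsGreatest (c '' Set.Ico (t i) (t (i + 1))) (c (t i)) := by
    refine fun i => ⟨⟨t i, ⟨le_rfl, ht i.lt_succ_self⟩, rfl⟩, ?_⟩
    rintro _ ⟨n, ⟨hn, hn'⟩, rfl⟩
    rcases hn.eq_or_lt with rfl | hlt
    · exact le_rfl
    · rw [(hV_compl n (ht_between i n hlt hn')).1]
      exact bot_le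
  refine (isWinning_block_iff ht hmax).1 (hE' (fun i => f (x (t i))) _ fun i => ?_)
  rw [hconst i _ (ht i.lt_succ_self) le_rfl]
  exact ht_mem i

end APT

/-! ### Trees as unfoldings of graphs -/

namespace LTree

variable {X : Type*} {L : Type}

theorem pref_succ (b : ℕ → ℕ) (n : ℕ) : pref b (n + 1) = pref b n ++ [b n] := by
  simp [pref, List.range_succ]

theorem pref_prefix_add (b : ℕ → ℕ) (m k : ℕ) : pref b m <+: pref b (m + k) := by
  induction k with
  | zero => exact List.prefix_rfl
  | succ k ih => exact ih.trans (pref_succ b (m + k) ▸ List.prefix_append _ _)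

/-- The vertex that is reached from `x₀` along a sequence of numbers of children, where the children
of a vertex are numbered by a list. -/
def walk (ch : X → List X) (x₀ : X) (p : List ℕ) : Option X :=
  p.foldl (fun o i => o.bind fun y => (ch y)[i]?) (some x₀)

theorem walk_concat (ch : X → List X) (x₀ : X) (p : List ℕ) (i : ℕ) :
    walk ch x₀ (p ++ [i]) = (walk ch x₀ p).bind fun y => (ch y)[i]? := by
  simp only [walk, List.foldl_append, List.foldl_cons, List.foldl_nil]

/-- The tree of the finite paths that start in `x₀` in a finitely branching graph, given by the sets
of successors `ch`. The successors of a vertex are numbered in an arbitrary way. -/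
noncomputable def unfold (ch : X → Set X) (hch : ∀ x, (ch x).Finite) (lab : X → L) (x₀ : X) :
    LTree L where
  nodes := {p | (walk (fun x => (hch x).toFinset.toList) x₀ p).isSome}
  root_mem := rfl
  parent_mem p i h := by
    rw [Set.mem_ofPred_eq, walk_concat] at h
    exact Option.isSome_of_isSome_bind h
  finite_children p := by
    cases hp : walk (fun x => (hch x).toFinset.toList) x₀ p with
    | none => simp [walk_concat, hp]
    | some y => simpa [walk_concat, hp] using Set.finite_lt_nat (hch y).toFinset.card
  label p := lab ((walk (fun x => (hch x).toFinset.toList) x₀ p).getD x₀)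

section Unfold

variable {ch : X → Set X} {hch : ∀ x, (ch x).Finite} {lab : X → L} {x₀ : X}

theorem unfold_label_nil : (unfold ch hch lab x₀).label [] = lab x₀ := rfl

theorem exists_of_mem_unfold_nodes {p : List ℕ} (hp : p ∈ (unfold ch hch lab x₀).nodes) :
    ∃ x, (unfold ch hch lab x₀).label p = lab x ∧
      ∀ l, (unfold ch hch lab x₀).ChildLabel p l ↔ ∃ y ∈ ch x, lab y = l := by
  obtain ⟨x, hx⟩ := Option.isSome_iff_exists.1 hp
  refine ⟨x, by simp only [unfold, hx, Option.getD_some], fun l => ⟨?_, ?_⟩⟩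
  · rintro ⟨i, hi, rfl⟩
    obtain ⟨y, hy⟩ := Option.isSome_iff_exists.1 hi
    refine ⟨y, ?_, by simp only [unfold, hy, Option.getD_some]⟩
    rw [walk_concat, hx] at hy
    simpa using List.mem_of_getElem? hy
  · rintro ⟨y, hy, rfl⟩
    obtain ⟨i, hi⟩ := List.mem_iff_getElem?.1 (Finset.mem_toList.2 ((hch x).mem_toFinset.2 hy))
    have hw : walk (fun x => (hch x).toFinset.toList) x₀ (p ++ [i]) = some y := by
      rw [walk_concat, hx]
      exact hi
    exact ⟨i, Option.isSome_iff_exists.2 ⟨y, hw⟩, by simp only [unfold, hw, Option.getD_some]⟩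

theorem exists_of_isBranch_unfold {b : ℕ → ℕ} (hb : (unfold ch hch lab x₀).IsBranch b) :
    ∃ x : ℕ → X, (∀ n, x (n + 1) ∈ ch (x n)) ∧
      ∀ n, (unfold ch hch lab x₀).label (pref b n) = lab (x n) := by
  choose x hx using fun n => Option.isSome_iff_exists.1 (hb n)
  refine ⟨x, fun n => ?_, fun n => by simp only [unfold, hx, Option.getD_some]⟩
  have hstep := hx (n + 1)
  rw [pref_succ, walk_concat, hx] at hstep
  simpa using List.mem_of_getElem? hstep

end Unfold

theorem mem_nodes_of_prefix_mem (t : LTree L) {p p' : List ℕ} (hp : p' ∈ t.nodes) (h : p <+: p') :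
    p ∈ t.nodes := by
  obtain ⟨r, rfl⟩ := h
  induction r using List.reverseRecOn with
  | nil => simpa using hp
  | append_singleton r i ih => exact ih (t.parent_mem _ i (by simpa using hp))

theorem exists_isBranch_extending (t : LTree L) {x : ℕ → List ℕ} (hx : ∀ n, x n ∈ t.nodes)
    (h : ∀ n, ∃ i, x (n + 1) = x n ++ [i]) :
    ∃ b, t.IsBranch b ∧ ∀ n, pref b (n + (x 0).length) = x n := by
  choose i hi using h
  let b (k : ℕ) : ℕ := (x 0)[k]?.getD (i (k - (x 0).length))
  have hpref : ∀ n, pref b (n + (x 0).length) = x n := by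
    intro n
    induction n with
    | zero => exact List.ext_getElem (by simp [pref]) fun k _ hk => by simp [pref, b, hk]
    | succ n ih => rw [Nat.add_right_comm, pref_succ, ih, hi]; simp [b]
  exact ⟨b, fun m => t.mem_nodes_of_prefix_mem (hx m) (hpref m ▸ pref_prefix_add b m _), hpref⟩

end LTree

namespace APT

open FinScottL

variable {S : Sig} {A : APT S}

theorem allPlaysWin_childEdges {L : Type} {t : LTree L} {f : L → A.Col}
    (h : ∀ b, t.IsBranch b → A.IsWinning fun n => f (t.label (LTree.pref b n))) :
    A.AllPlaysWin fun p c p' => p' ∈ t.nodes ∧ (∃ i, p' = p ++ [i]) ∧ f (t.label p') = c := by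
  intro x c hx
  obtain ⟨b, hb, hpref⟩ := t.exists_isBranch_extending
    (fun n => t.parent_mem (x n) _ ((hx n).2.1.choose_spec ▸ (hx n).1)) fun n => (hx n).2.1
  have hwin := (isWinning_shift_iff 1).2 ((isWinning_shift_iff (x 0).length).2 (h b hb))
  simpa only [hpref, (hx _).2.2] using hwin

theorem accepts_of_strategy {Y : Type*} {T : List ℕ → S.sym → Prop} {pos : Y → List ℕ}
    {state : Y → A.Q} {E : Y → A.Col → Y → Prop} (hE : A.AllPlaysWin E)
    (h : ∀ y, ∃ a, T (pos y) a ∧ ∃ φ ∈ A.δ (state y) a, ∀ p ∈ φ,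
      ∃ z, E y (A.col p.2) z ∧ pos z = pos y ++ [p.1.val] ∧ state z = p.2)
    {y₀ : Y} (h₀ : pos y₀ = []) : A.Accepts T (state y₀) := by
  choose a ha φ hφ next hnext using h
  let ch (y : Y) : Set Y := Set.range fun p : φ y => next y p.1 p.2
  refine ⟨LTree.unfold ch (fun _ => Set.finite_range _) (fun y => (pos y, state y)) y₀,
    ⟨by rw [LTree.unfold_label_nil, h₀], fun p hp => ?_⟩, fun b hb => ?_⟩
  · obtain ⟨y, hlabel, hchild⟩ := LTree.exists_of_mem_unfold_nodes hp
    rw [hlabel]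
    refine ⟨a y, ha y, φ y, hφ y, fun l => (hchild l).trans ?_⟩
    constructor
    · rintro ⟨_, ⟨⟨⟨d, q⟩, hp⟩, rfl⟩, rfl⟩
      exact ⟨d, q, hp, Prod.ext (hnext y _ hp).2.1 (hnext y _ hp).2.2⟩
    · rintro ⟨d, q, hp, rfl⟩
      exact ⟨_, ⟨⟨_, hp⟩, rfl⟩, Prod.ext (hnext y _ hp).2.1 (hnext y _ hp).2.2⟩
  · obtain ⟨y, hy, hlabel⟩ := LTree.exists_of_isBranch_unfold hb
    simp only [hlabel]
    rw [parityWin_iff, ← isWinning_shift_iff 1]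
    refine hE y _ fun n => ?_
    obtain ⟨⟨p, hp⟩, hyp⟩ := hy n
    rw [← hyp, (hnext _ p hp).2.2]
    exact (hnext _ p hp).1

/-- A winning strategy in the parity game of the fixpoint `Y(R)`, for an empty set of leaves: a
vertex labelled by `y` moves to all the elements of a context that `R` relates to `y`. -/
structure IsFixStrategy {X Y : FinScottL} (R : tensor (Bang A X) (Bang A Y) ⟶ Y) {W : Type*}
    (lab : W → Y) (E : W → A.Col → W → Prop) : Prop where
  step : ∀ w, ∃ v : Finset (A.Col × Y), (∀ p ∈ v, ∃ w', E w p.1 w' ∧ lab w' = p.2) ∧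
    R.rel ((∅ : Finset (A.Col × X)), v) (lab w)
  win : A.AllPlaysWin E

section Fixpoint

variable {X Y : FinScottL} {R : tensor (Bang A X) (Bang A Y) ⟶ Y}

theorem exists_isLeaf {w : LTree ((X ⊕ Y) × A.Col)} {p : List ℕ} (hp : p ∈ w.nodes) {x : X}
    (hx : (w.label p).1 = Sum.inl x) : ∃ c, A.IsLeaf w c x := by
  obtain ⟨c, hc, hmax⟩ := Set.exists_max_image {d | ∃ s, s <+: p ∧ (w.label s).2 = d} id
    (Set.toFinite _) ⟨_, p, List.prefix_rfl, rfl⟩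
  exact ⟨c, p, hp, hx, hc, hmax⟩

theorem exists_isFixStrategy_of_fixRel_empty {a : Y} (h : A.fixRel R ∅ a) :
    ∃ (W : Type) (lab : W → Y) (E : W → A.Col → W → Prop) (w₀ : W),
      A.IsFixStrategy R lab E ∧ lab w₀ = a := by
  obtain ⟨t, ht, hleaf, hwin⟩ := h
  have hnoleaf : ∀ p ∈ t.nodes, ∀ x, (t.label p).1 ≠ Sum.inl x := fun p hp x hx =>
    (exists_isLeaf hp hx).elim fun c hc => Finset.notMem_empty _ ((hleaf c x).2 hc)
  have hlab : ∀ p : t.nodes, ∃ b, (t.label p.1).1 = Sum.inr b := fun p =>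
    (Sum.isRight_iff).1 (Sum.not_isLeft.1 fun hl =>
      (Sum.isLeft_iff.1 hl).elim fun x hx => hnoleaf p.1 p.2 x hx)
  choose lab hlab using hlab
  have hlab_eq : ∀ (p : t.nodes) {b : Y} {c : A.Col}, t.label p.1 = (Sum.inr b, c) → lab p = b :=
    fun p b c hp => Sum.inr_injective ((hlab p).symm.trans (congrArg Prod.fst hp))
  have hE := allPlaysWin_childEdges (f := Prod.snd) fun b hb => colWin_iff.1 (hwin b hb)
  refine ⟨t.nodes, lab, fun p c p' => p'.1 ∈ t.nodes ∧ (∃ i, p'.1 = p.1 ++ [i]) ∧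
    (t.label p'.1).2 = c, ⟨[], t.root_mem⟩, ⟨fun p => ?_, fun x c hx => hE (fun n => (x n).1) c hx⟩,
    hlab_eq _ ht.root⟩
  obtain ⟨u, v, hu, hv, hR⟩ := ht.step p.1 p.2 _ (hlab p)
  obtain rfl : u = ∅ := Finset.eq_empty_of_forall_notMem fun ⟨c, x⟩ hx => by
    obtain ⟨i, hi, hl⟩ := (hu c x).1 hx
    exact hnoleaf _ hi x (congrArg Prod.fst hl)
  refine ⟨v, fun ⟨c, y⟩ hy => ?_, hR⟩
  obtain ⟨i, hi, hl⟩ := (hv c y).1 hy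
  exact ⟨⟨_, hi⟩, ⟨hi, ⟨i, rfl⟩, congrArg Prod.snd hl⟩, hlab_eq _ hl⟩

theorem IsFixStrategy.fixRel_empty {W : Type*} {lab : W → Y} {E : W → A.Col → W → Prop}
    (h : A.IsFixStrategy R lab E) (w₀ : W) : A.fixRel R ∅ (lab w₀) := by
  choose v hv hrel using h.step
  choose next hE hlab using hv
  let ch (x : W × A.Col) : Set (W × A.Col) := Set.range fun p : v x.1 => (next x.1 p.1 p.2, p.1.1)
  let labT (x : W × A.Col) : (X ⊕ Y) × A.Col := (Sum.inr (lab x.1), x.2)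
  let t := LTree.unfold ch (fun _ => Set.finite_range _) labT (w₀, ⊥)
  have hnode : ∀ p ∈ t.nodes, ∃ x : W, (t.label p).1 = Sum.inr (lab x) ∧
      ∀ l, t.ChildLabel p l ↔ ∃ z ∈ v x, (Sum.inr z.2, z.1) = l := by
    intro p hp
    obtain ⟨x, hlabel, hchild⟩ := LTree.exists_of_mem_unfold_nodes hp
    refine ⟨x.1, by rw [hlabel], fun l => (hchild l).trans ?_⟩
    constructor
    · rintro ⟨_, ⟨⟨z, hz⟩, rfl⟩, rfl⟩
      exact ⟨z, hz, by rw [← hlab x.1 z hz]⟩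
    · rintro ⟨z, hz, rfl⟩
      exact ⟨_, ⟨⟨z, hz⟩, rfl⟩, by simp only [labT, hlab]⟩
  have hnoleaf : ∀ p ∈ t.nodes, ∀ x, (t.label p).1 ≠ Sum.inl x := fun p hp x hx =>
    (hnode p hp).elim fun w hw => Sum.inr_ne_inl (hw.1.symm.trans hx)
  refine ⟨t, ⟨rfl, fun p hp x hx => (hnoleaf p hp x hx).elim, fun p hp b hb => ?_⟩,
    fun c x => ⟨fun hx => (Finset.notMem_empty _ hx).elim, ?_⟩, fun b hb => ?_⟩
  · obtain ⟨x, hlabel, hchild⟩ := hnode p hp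
    obtain rfl := Sum.inr_injective (hlabel.symm.trans hb)
    exact ⟨∅, v x, fun c y => by simp [hchild], fun c y => by simp [hchild], hrel x⟩
  · rintro ⟨p, hp, hx, -⟩
    exact (hnoleaf p hp x hx).elim
  · obtain ⟨x, hx, hlabel⟩ := LTree.exists_of_isBranch_unfold hb
    rw [colWin_iff, ← isWinning_shift_iff 1]
    refine h.win (fun n => (x n).1) _ fun n => ?_
    obtain ⟨⟨p, hp⟩, hxp⟩ := hx n
    rw [hlabel, ← hxp]
    exact hE _ p hp

end Fixpoint

end APT

/-! ### Head reduction -/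

section Spine

variable {S : Sig} {N : Type} {ty : N → Ty}

/-- The decomposition of a closed term of ground type into its head and its arguments. -/
inductive Spine (S : Sig) {N : Type} (ty : N → Ty) : Type
  | const (a : S.sym) (as : Args S ty (Ty.first (S.ar a)))
  | nt (F : N) (as : Args S ty (ty F))

/-- The spine of the term `M t₁ … tₙ`. -/
def Term.spine : ∀ {σ : Ty}, Term S ty [] σ → Args S ty σ → Spine S ty
  | _, .const a, as => .const a as
  | _, .nt F, as => .nt F as
  | _, .app M P, as => M.spine (.cons P as)

namespace Args

theorem spine_apply : ∀ {σ : Ty} (as : Args S ty σ) (M : Term S ty [] σ),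
    (as.apply M).spine .nil = M.spine as
  | _, .nil, _ => rfl
  | _, .cons P as, M => as.spine_apply (.app M P)

theorem spine_eq_of_apply_eq {σ τ : Ty} {as : Args S ty σ} {as' : Args S ty τ}
    {M : Term S ty [] σ} {M' : Term S ty [] τ} (h : as.apply M = as'.apply M') :
    M.spine as = M'.spine as' := by
  rw [← as.spine_apply M, h, as'.spine_apply M']

theorem apply_nt_inj {F F' : N} {as : Args S ty (ty F)} {as' : Args S ty (ty F')}
    (h : as.apply (.nt F) = as'.apply (.nt F')) : Spine.nt F as = Spine.nt F' as' :=
  spine_eq_of_apply_eq h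

theorem apply_const_inj {a a' : S.sym} {as : Args S ty (Ty.first (S.ar a))}
    {as' : Args S ty (Ty.first (S.ar a'))}
    (h : as.apply (.const a) = as'.apply (.const a')) : Spine.const a as = Spine.const a' as' :=
  spine_eq_of_apply_eq h

theorem apply_const_ne_nt {a : S.sym} {F : N} {as : Args S ty (Ty.first (S.ar a))}
    {as' : Args S ty (ty F)} : as.apply (.const a) ≠ as'.apply (.nt F) :=
  fun h => nomatch spine_eq_of_apply_eq h

/-- The first argument. -/
def head {σ τ : Ty} : Args S ty (.arr σ τ) → Term S ty [] σ
  | .cons t _ => t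

/-- The arguments after the first one. -/
def tail {σ τ : Ty} : Args S ty (.arr σ τ) → Args S ty τ
  | .cons _ as => as

theorem eq_nil : ∀ as : Args S ty .o, as = .nil
  | .nil => rfl

theorem apply_cast {σ : Ty} (h : σ = .o) (M : Term S ty [] σ) :
    Args.apply M (h.symm ▸ Args.nil) = h ▸ M := by
  subst h
  rfl

/-- The arguments of a symbol of arity `n`, as a family. -/
def get : ∀ {n : ℕ}, Args S ty (Ty.first n) → Fin n → Term S ty [] .o
  | 0, _ => Fin.elim0
  | _ + 1, as => Fin.cons as.head as.tail.get

theorem appN_get : ∀ {n : ℕ} (as : Args S ty (Ty.first n)) (M : Term S ty [] (Ty.first n)),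
    Term.appN M as.get = as.apply M
  | 0, as, M => by rw [as.eq_nil]; rfl
  | _ + 1, .cons t as, M => as.appN_get (.app M t)

theorem exists_get_eq : ∀ {n : ℕ} (ts : Fin n → Term S ty [] .o),
    ∃ as : Args S ty (Ty.first n), as.get = ts
  | 0, ts => ⟨.nil, funext fun i => i.elim0⟩
  | _ + 1, ts => by
    obtain ⟨as, has⟩ := exists_get_eq (Fin.tail ts)
    refine ⟨.cons (ts 0) as, funext fun i => ?_⟩
    cases i using Fin.cases with
    | zero => rfl
    | succ i => exact congrFun has i

end Args

end Spine

namespace HORS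

variable {S : Sig} (G : HORS S)

/-- Head reduction of closed terms of ground type. -/
inductive HeadStep : Term S G.ty [] .o → Term S G.ty [] .o → Prop
  | rule (F : G.N) (as : Args S G.ty (G.ty F)) :
      HeadStep (as.apply (.nt F)) ((G.rule F).inst Env.nil as)

/-- `HeadValue t p a`: the position `p` of the value tree of `t` carries `a`, as witnessed by head
reductions only. -/
inductive HeadValue : Term S G.ty [] .o → List ℕ → S.sym → Prop
  | head {t t' p a} (hs : G.HeadStep t t') (h : HeadValue t' p a) : HeadValue t p a
  | root (a : S.sym) (as : Args S G.ty (Ty.first (S.ar a))) : HeadValue (as.apply (.const a)) [] a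
  | child (a : S.sym) (as : Args S G.ty (Ty.first (S.ar a))) (i : Fin (S.ar a)) {p b}
      (h : HeadValue (as.get i) p b) : HeadValue (as.apply (.const a)) (i.val :: p) b

variable {G}

theorem HeadStep.step {t t' : Term S G.ty [] .o} (h : G.HeadStep t t') : G.Step t t' := by
  cases h with
  | rule F as => exact .rule F as

theorem HeadStep.eq_inst {F : G.N} {as : Args S G.ty (G.ty F)} {t' : Term S G.ty [] .o}
    (h : G.HeadStep (as.apply (.nt F)) t') : t' = (G.rule F).inst Env.nil as := by
  generalize ht : as.apply (.nt F) = t at h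
  cases h with
  | rule F' as' => cases Args.apply_nt_inj ht; rfl

theorem HeadStep.unique {t t₁ t₂ : Term S G.ty [] .o} (h₁ : G.HeadStep t t₁)
    (h₂ : G.HeadStep t t₂) : t₁ = t₂ := by
  cases h₁ with
  | rule F as => exact h₂.eq_inst.symm

theorem not_headStep_const {a : S.sym} {as : Args S G.ty (Ty.first (S.ar a))}
    {t : Term S G.ty [] .o} : ¬ G.HeadStep (as.apply (.const a)) t := by
  generalize hs : as.apply (.const a) = s
  rintro ⟨F, as'⟩
  exact Args.apply_const_ne_nt hs

namespace HeadValue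

theorem of_labelAt {t : Term S G.ty [] .o} {p : List ℕ} {a : S.sym} (h : LabelAt t p a) :
    G.HeadValue t p a := by
  induction h with
  | root a ts =>
    obtain ⟨as, rfl⟩ := Args.exists_get_eq ts
    rw [Args.appN_get]
    exact .root a as
  | child a ts i p b _ ih =>
    obtain ⟨as, rfl⟩ := Args.exists_get_eq ts
    rw [Args.appN_get]
    exact .child a as i ih

theorem of_headSteps {t t' : Term S G.ty [] .o} {p : List ℕ} {a : S.sym}
    (h : Relation.ReflTransGen G.HeadStep t t') (ha : G.HeadValue t' p a) : G.HeadValue t p a :=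
  h.head_induction_on ha fun hs _ ih => .head hs ih

theorem of_headStep {t t' : Term S G.ty [] .o} {p : List ℕ} {a : S.sym} (h : G.HeadValue t p a)
    (hs : G.HeadStep t t') : G.HeadValue t' p a := by
  cases h with
  | head hs' h => exact hs.unique hs' ▸ h
  | root => exact (not_headStep_const hs).elim
  | child => exact (not_headStep_const hs).elim

theorem of_const_child {b : S.sym} {as : Args S G.ty (Ty.first (S.ar b))} {a : S.sym}
    {i : Fin (S.ar b)} {p : List ℕ} (h : G.HeadValue (as.apply (.const b)) (i.val :: p) a) :
    G.HeadValue (as.get i) p a := by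
  generalize ht : as.apply (.const b) = t at h
  generalize hp : i.val :: p = p' at h
  cases h with
  | head hs => exact (not_headStep_const (ht ▸ hs)).elim
  | root => cases hp
  | child a' as' j h =>
    cases Args.apply_const_inj ht
    obtain ⟨hij, rfl⟩ := List.cons.inj hp
    rwa [Fin.ext hij]

theorem acc_headStep {t : Term S G.ty [] .o} {p : List ℕ} {a : S.sym} (h : G.HeadValue t p a) :
    Acc (fun t' t => G.HeadStep t t') t := by
  induction h with
  | head hs _ ih => exact .intro _ fun t' hs' => hs.unique hs' ▸ ih
  | root => exact .intro _ fun t' hs => (not_headStep_const hs).elim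
  | child => exact .intro _ fun t' hs => (not_headStep_const hs).elim

end HeadValue

/-! ### Standardization -/

variable (G)

/-- Standard reduction: head reductions of subterms of ground type, followed by reductions of this
kind in the immediate subterms. -/
inductive StdRed : ∀ {σ : Ty}, Term S G.ty [] σ → Term S G.ty [] σ → Prop
  | head {t t₁ t'} (hs : G.HeadStep t t₁) (h : StdRed t₁ t') : StdRed t t'
  | const (a : S.sym) : StdRed (.const a) (.const a)
  | nt (F : G.N) : StdRed (.nt F) (.nt F)
  | app {σ τ : Ty} {M M' : Term S G.ty [] (.arr σ τ)} {P P' : Term S G.ty [] σ} (h : StdRed M M')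
      (k : StdRed P P') : StdRed (.app M P) (.app M' P')

/-- Argumentwise standard reduction. -/
inductive StdRedArgs : ∀ {σ : Ty}, Args S G.ty σ → Args S G.ty σ → Prop
  | nil : StdRedArgs .nil .nil
  | cons {σ τ : Ty} {t t' : Term S G.ty [] σ} {as as' : Args S G.ty τ} (h : G.StdRed t t')
      (k : StdRedArgs as as') : StdRedArgs (.cons t as) (.cons t' as')

/-- Standard reduction of the arguments below a fixed head. -/
inductive StdRedBelow : Term S G.ty [] .o → Term S G.ty [] .o → Prop
  | const (a : S.sym) {as as' : Args S G.ty (Ty.first (S.ar a))} (h : G.StdRedArgs as as') :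
      StdRedBelow (as.apply (.const a)) (as'.apply (.const a))
  | nt (F : G.N) {as as' : Args S G.ty (G.ty F)} (h : G.StdRedArgs as as') :
      StdRedBelow (as.apply (.nt F)) (as'.apply (.nt F))

variable {G}

theorem StdRedArgs.get : ∀ {n : ℕ} {as as' : Args S G.ty (Ty.first n)}, G.StdRedArgs as as' →
    ∀ i, G.StdRed (as.get i) (as'.get i)
  | 0, _, _, _, i => i.elim0
  | _ + 1, _, _, .cons h k, i => Fin.cases h (StdRedArgs.get k) i

namespace StdRed

theorem refl : ∀ {σ : Ty} (t : Term S G.ty [] σ), G.StdRed t t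
  | _, .const a => .const a
  | _, .nt F => .nt F
  | _, .app M P => .app (refl M) (refl P)

theorem of_step {σ : Ty} {t t' : Term S G.ty [] σ} (h : G.Step t t') : G.StdRed t t' := by
  induction h with
  | rule F as => exact .head (.rule F as) (refl _)
  | left P _ ih => exact .app ih (refl P)
  | right M _ ih => exact .app (refl M) ih

theorem subst {Γ : List Ty} {ρ ρ' : Env S G.ty Γ} (hρ : ∀ σ x, G.StdRed (ρ σ x) (ρ' σ x)) :
    ∀ {σ : Ty} (M : Term S G.ty Γ σ), G.StdRed (M.subst ρ) (M.subst ρ')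
  | _, .const a => .const a
  | _, .nt F => .nt F
  | _, .var x => hρ _ x
  | _, .app M P => .app (subst hρ M) (subst hρ P)

theorem inst {Γ : List Ty} {σ : Ty} (r : Rule S G.ty Γ σ) {ρ ρ' : Env S G.ty Γ}
    (hρ : ∀ σ x, G.StdRed (ρ σ x) (ρ' σ x)) {as as' : Args S G.ty σ} (h : G.StdRedArgs as as') :
    G.StdRed (r.inst ρ as) (r.inst ρ' as') := by
  induction r with
  | body t => cases h; exact subst hρ t
  | lam r ih =>
    cases h with
    | cons h k =>
      refine ih (fun σ x => ?_) k
      cases x with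
      | zero => exact h
      | succ x => exact hρ _ x

theorem exists_headSteps_apply {σ : Ty} {M M' : Term S G.ty [] σ} (h : G.StdRed M M') :
    ∀ {as as' : Args S G.ty σ}, G.StdRedArgs as as' →
      ∃ s, Relation.ReflTransGen G.HeadStep (as.apply M) s ∧ G.StdRedBelow s (as'.apply M') := by
  induction h with
  | head hs _ ih =>
    intro as as' has
    cases has
    obtain ⟨s, hts, hs'⟩ := ih .nil
    exact ⟨s, hts.head hs, hs'⟩
  | const a => exact fun has => ⟨_, .refl, .const a has⟩
  | nt F => exact fun has => ⟨_, .refl, .nt F has⟩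
  | app _ k ih _ => exact fun has => ih (.cons k has)

theorem exists_headSteps {t t' : Term S G.ty [] .o} (h : G.StdRed t t') :
    ∃ s, Relation.ReflTransGen G.HeadStep t s ∧ G.StdRedBelow s t' :=
  h.exists_headSteps_apply .nil

end StdRed

namespace StdRedBelow

theorem exists_of_nt {t : Term S G.ty [] .o} {F : G.N} {as : Args S G.ty (G.ty F)}
    (h : G.StdRedBelow t (as.apply (.nt F))) :
    ∃ bs : Args S G.ty (G.ty F), t = bs.apply (.nt F) ∧ G.StdRedArgs bs as := by
  generalize hs : as.apply (.nt F) = s at h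
  cases h with
  | const => exact (Args.apply_const_ne_nt hs.symm).elim
  | nt F' h => cases Args.apply_nt_inj hs; exact ⟨_, rfl, h⟩

theorem exists_of_const {t : Term S G.ty [] .o} {a : S.sym}
    {as : Args S G.ty (Ty.first (S.ar a))} (h : G.StdRedBelow t (as.apply (.const a))) :
    ∃ bs : Args S G.ty (Ty.first (S.ar a)), t = bs.apply (.const a) ∧ G.StdRedArgs bs as := by
  generalize hs : as.apply (.const a) = s at h
  cases h with
  | const a' h => cases Args.apply_const_inj hs; exact ⟨_, rfl, h⟩
  | nt => exact (Args.apply_const_ne_nt hs).elim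

end StdRedBelow

theorem HeadValue.of_stdRed {t' : Term S G.ty [] .o} {p : List ℕ} {a : S.sym}
    (ha : G.HeadValue t' p a) : ∀ {t}, G.StdRed t t' → G.HeadValue t p a := by
  induction ha with
  | head hs _ ih =>
    intro t h
    obtain ⟨s, hts, hs'⟩ := h.exists_headSteps
    cases hs with
    | rule F as =>
      obtain ⟨bs, rfl, hbs⟩ := hs'.exists_of_nt
      have hbody : G.StdRed ((G.rule F).inst Env.nil bs) ((G.rule F).inst Env.nil as) :=
        .inst _ (fun _ (x : Var [] _) => nomatch x) hbs
      exact of_headSteps (hts.tail (.rule F bs)) (ih hbody)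
  | root a as =>
    intro t h
    obtain ⟨s, hts, hs⟩ := h.exists_headSteps
    obtain ⟨bs, rfl, -⟩ := hs.exists_of_const
    exact of_headSteps hts (.root a bs)
  | child a as i _ ih =>
    intro t h
    obtain ⟨s, hts, hs⟩ := h.exists_headSteps
    obtain ⟨bs, rfl, hbs⟩ := hs.exists_of_const
    exact of_headSteps hts (.child a bs i (ih (hbs.get i)))

theorem headValue_of_valueTree {p : List ℕ} {a : S.sym} (h : G.valueTree p a) :
    G.HeadValue G.startTerm p a := by
  obtain ⟨t, hr, hl⟩ := h
  exact hr.head_induction_on (.of_labelAt hl) fun hs _ ih => ih.of_stdRed (.of_step hs)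

/-! ### Subterms of the terms that compute the value tree -/

variable (G)

/-- `SubAt T p t`: the position `p` of `T` is reached through symbols of the alphabet only, and `t`
is the subterm at this position. -/
inductive SubAt : Term S G.ty [] .o → List ℕ → Term S G.ty [] .o → Prop
  | nil (t) : SubAt t [] t
  | cons (a : S.sym) (as : Args S G.ty (Ty.first (S.ar a))) (i : Fin (S.ar a)) {p t}
      (h : SubAt (as.get i) p t) : SubAt (as.apply (.const a)) (i.val :: p) t

/-- The term `t` occurs at the position `p`, reached through symbols of the alphabet only, in some
term obtained from the start symbol. -/
def Occurs (p : List ℕ) (t : Term S G.ty [] .o) : Prop :=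
  ∃ T, Relation.ReflTransGen G.Step G.startTerm T ∧ G.SubAt T p t

variable {G}

theorem steps_apply : ∀ {σ : Ty} (as : Args S G.ty σ) {M M' : Term S G.ty [] σ},
    Relation.ReflTransGen G.Step M M' → Relation.ReflTransGen G.Step (as.apply M) (as.apply M')
  | _, .nil, _, _, h => h
  | _, .cons P as, _, _, h => steps_apply as (h.lift (Term.app · P) fun _ _ => .left P)

theorem exists_steps_of_steps_get : ∀ {n : ℕ} (as : Args S G.ty (Ty.first n))
    (M : Term S G.ty [] (Ty.first n)) (i : Fin n) {u : Term S G.ty [] .o},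
    Relation.ReflTransGen G.Step (as.get i) u → ∃ as' : Args S G.ty (Ty.first n),
      Relation.ReflTransGen G.Step (as.apply M) (as'.apply M) ∧ as'.get i = u
  | 0, _, _, i, _, _ => i.elim0
  | _ + 1, .cons t as, M, i, u, h => by
    induction i using Fin.cases with
    | zero => exact ⟨.cons u as, steps_apply as (h.lift (Term.app M) fun _ _ => .right M), rfl⟩
    | succ i =>
      obtain ⟨as', hsteps, rfl⟩ := exists_steps_of_steps_get as (.app M t) i h
      exact ⟨.cons t as', hsteps, rfl⟩

namespace SubAt

theorem labelAt {T : Term S G.ty [] .o} {p : List ℕ} {a : S.sym}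
    {as : Args S G.ty (Ty.first (S.ar a))} (h : G.SubAt T p (as.apply (.const a))) :
    LabelAt T p a := by
  generalize ht : as.apply (.const a) = t at h
  induction h with
  | nil =>
    rw [← ht, ← Args.appN_get]
    exact .root a _
  | cons b bs i _ ih =>
    rw [← Args.appN_get]
    exact .child b _ i _ _ (ih ht)

theorem concat {T : Term S G.ty [] .o} {p : List ℕ} {a : S.sym}
    {as : Args S G.ty (Ty.first (S.ar a))} (h : G.SubAt T p (as.apply (.const a)))
    (i : Fin (S.ar a)) : G.SubAt T (p ++ [i.val]) (as.get i) := by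
  generalize ht : as.apply (.const a) = t at h
  induction h with
  | nil =>
    rw [← ht]
    exact .cons a as i (.nil _)
  | cons b bs j _ ih => exact .cons b bs j (ih ht)

theorem exists_steps {T : Term S G.ty [] .o} {p : List ℕ} {t t' : Term S G.ty [] .o}
    (h : G.SubAt T p t) (hr : Relation.ReflTransGen G.Step t t') :
    ∃ T', Relation.ReflTransGen G.Step T T' ∧ G.SubAt T' p t' := by
  induction h with
  | nil => exact ⟨t', hr, .nil _⟩
  | cons a as i _ ih =>
    obtain ⟨u, hu, hsub⟩ := ih hr
    obtain ⟨as', hsteps, rfl⟩ := exists_steps_of_steps_get as (.const a) i hu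
    exact ⟨_, hsteps, .cons a as' i hsub⟩

end SubAt

namespace Occurs

variable {p : List ℕ} {t t' : Term S G.ty [] .o}

theorem startTerm : G.Occurs [] G.startTerm := ⟨_, .refl, .nil _⟩

theorem headSteps (h : G.Occurs p t) (hs : Relation.ReflTransGen G.HeadStep t t') :
    G.Occurs p t' := by
  obtain ⟨T, hT, hsub⟩ := h
  obtain ⟨T', hT', hsub'⟩ := hsub.exists_steps (hs.lift id fun _ _ => HeadStep.step)
  exact ⟨T', hT.trans hT', hsub'⟩

theorem get {a : S.sym} {as : Args S G.ty (Ty.first (S.ar a))}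
    (h : G.Occurs p (as.apply (.const a))) (i : Fin (S.ar a)) :
    G.Occurs (p ++ [i.val]) (as.get i) := by
  obtain ⟨T, hT, hsub⟩ := h
  exact ⟨T, hT, hsub.concat i⟩

theorem valueTree {a : S.sym} {as : Args S G.ty (Ty.first (S.ar a))}
    (h : G.Occurs p (as.apply (.const a))) : G.valueTree p a := by
  obtain ⟨T, hT, hsub⟩ := h
  exact ⟨T, hT, hsub.labelAt⟩

end Occurs

end HORS

/-! ### Acceptance games -/

namespace APT

variable {S : Sig} (A : APT S) (G : HORS S)

section

variable {X : Type*} (term : X → Term S G.ty [] .o) (state : X → A.Q) (E : X → A.Col → X → Prop)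

/-- At the vertex `x`, where the symbol `a` is read with arguments `as`, the strategy `E` selects a
clause of the automaton and has a move for each of its pairs (direction, state). -/
def Responds (x : X) (a : S.sym) (as : Args S G.ty (Ty.first (S.ar a))) : Prop :=
  ∃ φ ∈ A.δ (state x) a, ∀ p ∈ φ, ∃ y, E x (A.col p.2) y ∧ term y = as.get p.1 ∧ state y = p.2

/-- A winning strategy in the acceptance game on closed terms. Until a symbol is read, the term
evolves according to `r` in silent moves, which have the neutral colour. -/
structure IsEvalStrategy (r : Term S G.ty [] .o → Term S G.ty [] .o → Prop) : Prop where
  step : ∀ x, (∃ y, E x ⊥ y ∧ r (term x) (term y) ∧ state y = state x) ∨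
    ∃ a as, term x = Args.apply (.const a) as ∧ A.Responds G term state E x a as
  win : A.AllPlaysWin E

end

variable {A G}

section

variable {X : Type*} {term : X → Term S G.ty [] .o} {state : X → A.Q} {E : X → A.Col → X → Prop}
  {r : Term S G.ty [] .o → Term S G.ty [] .o → Prop}

theorem Responds.of_silent {x y : X} {a : S.sym} {as : Args S G.ty (Ty.first (S.ar a))}
    (h : A.Responds G term state (Path E) y a as) (hE : E x ⊥ y) (hstate : state y = state x) :
    A.Responds G term state (Path E) x a as := by
  obtain ⟨φ, hφ, hmove⟩ := h
  refine ⟨φ, hstate ▸ hφ, fun p hp => ?_⟩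
  obtain ⟨z, hz, hterm⟩ := hmove p hp
  exact ⟨z, max_bot_left (A.col p.2) ▸ Path.cons hE hz, hterm⟩

theorem Responds.path {x : X} {a : S.sym} {as : Args S G.ty (Ty.first (S.ar a))}
    (h : A.Responds G term state E x a as) : A.Responds G term state (Path E) x a as := by
  obtain ⟨φ, hφ, hmove⟩ := h
  refine ⟨φ, hφ, fun p hp => ?_⟩
  obtain ⟨z, hz, hterm⟩ := hmove p hp
  exact ⟨z, .single hz, hterm⟩

namespace IsEvalStrategy

theorem headStep (h : A.IsEvalStrategy G term state E G.HeadStep) {x : X}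
    {t : Term S G.ty [] .o} (ht : G.HeadStep (term x) t) :
    ∃ y, E x ⊥ y ∧ term y = t ∧ state y = state x := by
  rcases h.step x with ⟨y, hE, hr, hstate⟩ | ⟨a, as, hterm, -⟩
  · exact ⟨y, hE, hr.unique ht, hstate⟩
  · exact (HORS.not_headStep_const (hterm ▸ ht)).elim

theorem responds (h : A.IsEvalStrategy G term state E G.HeadStep) {x : X} {a : S.sym}
    {as : Args S G.ty (Ty.first (S.ar a))} (hx : term x = as.apply (.const a)) :
    A.Responds G term state E x a as := by
  rcases h.step x with ⟨y, -, hr, -⟩ | ⟨b, bs, hterm, hb⟩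
  · exact (HORS.not_headStep_const (hx ▸ hr)).elim
  · cases Args.apply_const_inj (hterm.symm.trans hx)
    exact hb

theorem exists_responds
    (h : A.IsEvalStrategy G term state E r) (x : X) :
    ∃ a as, Relation.ReflTransGen r (term x) (Args.apply (.const a) as) ∧
      A.Responds G term state (Path E) x a as := by
  induction x using (h.win.wellFounded not_isWinning_bot).induction with
  | _ x ih =>
    rcases h.step x with ⟨y, hE, hr, hstate⟩ | ⟨a, as, hterm, hresp⟩
    · obtain ⟨a, as, hsteps, hresp⟩ := ih y hE
      exact ⟨a, as, .head hr hsteps, hresp.of_silent hE hstate⟩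
    · exact ⟨a, as, hterm ▸ .refl, hresp.path⟩

theorem accepts (h : A.IsEvalStrategy G term state E r)
    (hr : ∀ t u, r t u → Relation.ReflTransGen G.HeadStep t u) {x₀ : X}
    (h₀ : term x₀ = G.startTerm) : A.Accepts G.valueTree (state x₀) := by
  let Y := {y : X × List ℕ // G.Occurs y.2 (term y.1)}
  let E' (y : Y) (c : A.Col) (z : Y) : Prop := Path E y.1.1 c z.1.1
  refine accepts_of_strategy (Y := Y) (pos := fun y => y.1.2) (state := fun y => state y.1.1)
    (E := E') (fun y c hy => h.win.path _ c hy) (fun y => ?_)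
    (y₀ := ⟨(x₀, []), h₀ ▸ .startTerm⟩) rfl
  obtain ⟨a, as, hsteps, φ, hφ, hmove⟩ := h.exists_responds y.1.1
  have hocc : G.Occurs y.1.2 (as.apply (.const a)) :=
    y.2.headSteps (Relation.reflTransGen_closed hr _ _ hsteps)
  refine ⟨a, hocc.valueTree, φ, hφ, fun p hp => ?_⟩
  obtain ⟨z, hE, hterm, hstate⟩ := hmove p hp
  exact ⟨⟨(z, y.1.2 ++ [p.1.val]), hterm ▸ hocc.get p.1⟩, hE, rfl, hstate⟩

end IsEvalStrategy

end

theorem exists_isEvalStrategy_of_accepts {q₀ : A.Q} (h : A.Accepts G.valueTree q₀) :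
    ∃ (X : Type) (term : X → Term S G.ty [] .o) (state : X → A.Q) (E : X → A.Col → X → Prop)
      (x₀ : X), A.IsEvalStrategy G term state E G.HeadStep ∧ term x₀ = G.startTerm ∧
        state x₀ = q₀ := by
  obtain ⟨t, ht, hwin⟩ := h
  let X := {x : List ℕ × Term S G.ty [] .o // x.1 ∈ t.nodes ∧
    ∀ p b, G.valueTree ((t.label x.1).1 ++ p) b → G.HeadValue x.2 p b}
  let silent (y x : X) : Prop := G.HeadStep x.1.2 y.1.2
  let E' (p : List ℕ) (c : A.Col) (p' : List ℕ) : Prop :=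
    p' ∈ t.nodes ∧ (∃ i, p' = p ++ [i]) ∧ A.col (t.label p').2 = c
  let E (x : X) (c : A.Col) (y : X) : Prop :=
    c = ⊥ ∧ y.1.1 = x.1.1 ∧ silent y x ∨ E' x.1.1 c y.1.1
  have hvalue : ∀ x : X, ∃ a, G.HeadValue x.1.2 [] a ∧ ∃ φ ∈ A.δ (t.label x.1.1).2 a,
      ∀ l, t.ChildLabel x.1.1 l ↔ ∃ d q, (d, q) ∈ φ ∧ l = ((t.label x.1.1).1 ++ [d.val], q) :=
    fun x => (ht.step x.1.1 x.2.1).imp fun a ⟨ha, hφ⟩ =>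
      ⟨x.2.2 [] a (by rwa [List.append_nil]), hφ⟩
  have hsilent : WellFounded silent := ⟨fun x =>
    (hvalue x).elim fun a ha => InvImage.accessible (fun x : X => x.1.2) ha.1.acc_headStep⟩
  have hE' : A.AllPlaysWin E' :=
    allPlaysWin_childEdges (f := fun l => A.col l.2) fun b hb => parityWin_iff.1 (hwin b hb)
  refine ⟨X, fun x => x.1.2, fun x => (t.label x.1.1).2, E, ⟨([], G.startTerm), t.root_mem,
    fun p b hp => ?_⟩, ⟨?_, hE'.of_silent hsilent fun x c y hxy => hxy⟩, rfl,
    congrArg Prod.snd ht.root⟩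
  · rw [ht.root] at hp
    exact HORS.headValue_of_valueTree hp
  · rintro ⟨⟨p, M⟩, hp, hM⟩
    obtain ⟨a, ha, φ, hφ, hchild⟩ := hvalue ⟨(p, M), hp, hM⟩
    cases ha with
    | @head _ M' _ _ hs _ =>
      exact .inl ⟨⟨(p, M'), hp, fun p b hb => (hM p b hb).of_headStep hs⟩,
        .inl ⟨rfl, rfl, hs⟩, hs, rfl⟩
    | root a as =>
      refine .inr ⟨a, as, rfl, φ, hφ, fun ⟨d, q⟩ hdq => ?_⟩
      obtain ⟨i, hi, hlabel⟩ := (hchild _).2 ⟨d, q, hdq, rfl⟩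
      refine ⟨⟨(p ++ [i], as.get d), hi, fun p' b hb => ?_⟩, .inr ⟨hi, ⟨i, rfl⟩, by rw [hlabel]⟩,
        rfl, congrArg Prod.snd hlabel⟩
      rw [hlabel, List.append_assoc] at hb
      exact (hM (d.val :: p') b hb).of_const_child

end APT

namespace APT

open FinScottL

/-! ### The morphisms of the model on elements -/

section Model

variable {S : Sig} {A : APT S} {X Y Z : FinScottL}

variable (A) in
/-- The part of a context that remains available below the colour `c`: the comultiplication of `□`
splits a colour as a maximum. -/
noncomputable def shift (u : Finset (A.Col × X)) (c : A.Col) : Finset (A.Col × X) :=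
  (Set.toFinite {z : A.Col × X | (max c z.1, z.2) ∈ u}).toFinset

theorem mem_shift {u : Finset (A.Col × X)} {c : A.Col} {z : A.Col × X} :
    z ∈ A.shift u c ↔ (max c z.1, z.2) ∈ u := by
  rw [shift, Set.Finite.mem_toFinset, Set.mem_ofPred_eq]

theorem bang_le_of_subset {u v : Finset (A.Col × X)} (h : u ⊆ v) : (show A.Bang X from u) ≤ v :=
  fun z hz => ⟨z, h hz, rfl, le_rfl⟩

theorem promote_rel {T : A.KHom X Y} {u : Finset (A.Col × X)} {v : Finset (A.Col × Y)} :
    (A.promote T).rel u v ↔ ∀ p ∈ v, T.rel (A.shift u p.1) p.2 := by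
  constructor
  · rintro ⟨U, hU, h⟩ p hp
    obtain ⟨x, hx, hxp, hT⟩ := h p hp
    refine T.down hT (fun z hz => ?_) le_rfl
    obtain ⟨a, ha, hza⟩ := (cbDig_rel A.Col).1 hU x hx z hz
    refine ⟨(z.1, a), mem_shift.2 ?_, rfl, hza⟩
    rw [← (show x.1 = p.1 from hxp)]
    exact ha
  · intro h
    obtain ⟨U, hU⟩ := exists_finset fun y : A.Col × Finset (A.Col × X) =>
      ∀ z ∈ y.2, ∃ a', (max y.1 z.1, a') ∈ u ∧ z.2 ≤ a'
    refine ⟨U, (cbDig_rel A.Col).2 fun y hy => (hU y).1 hy, fun p hp => ?_⟩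
    exact ⟨(p.1, A.shift u p.1), (hU _).2 fun z hz => ⟨z.2, mem_shift.1 hz, le_rfl⟩, rfl, h p hp⟩

theorem apply_rel {R : A.KHom X (lolli (Bang A Y) Z)} {T : A.KHom X Y} {u : Finset (A.Col × X)}
    {z : Z} : (A.apply R T).rel u z ↔ ∃ v : Finset (A.Col × Y), R.rel u (v, z) ∧
      ∀ p ∈ v, T.rel (A.shift u p.1) p.2 :=
  exists_congr fun _ => and_congr_right fun _ => promote_rel

theorem der_comp_rel {R : X ⟶ Y} {u : Finset (A.Col × X)} {y : Y} :
    ((cb A.Col).ε.app X ≫ R).rel u y ↔ ∃ x, (⊥, x) ∈ u ∧ R.rel x y := by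
  constructor
  · rintro ⟨x, hx, hR⟩
    obtain ⟨x', hx', hle⟩ := (cbDer_rel A.Col).1 hx
    exact ⟨x', hx', R.down hR hle le_rfl⟩
  · rintro ⟨x, hx, hR⟩
    exact ⟨x, (cbDer_rel A.Col).2 ⟨x, hx, le_rfl⟩, hR⟩

end Model

/-! ### From acceptance to the model -/

section Usage

variable {S : Sig} (A : APT S) {N : Type} {ty : N → Ty} {X : Type*} (term : X → Term S ty [] .o)
  (state : X → A.Q) (E : X → A.Col → X → Prop)

/-- The element of `A.den σ` that describes how the head of the term at the vertex `x`, applied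
to the arguments `as`, uses them: an argument is used at the vertices below `x` where it is
the head of the term, with the greatest colour on the way from `x`. -/
noncomputable def usageAt : ∀ σ : Ty, X → Args S ty σ → A.den σ
  | .o, x, _ => state x
  | .arr σ τ, x, as =>
    ((Set.toFinite {p : A.Col × A.den σ | ∃ y bs, Reach E x p.1 y ∧
      term y = Args.apply as.head bs ∧ p.2 = usageAt σ y bs}).toFinset, usageAt τ x as.tail)

variable {A term state E}

theorem mem_usageAt {σ τ : Ty} {x : X} {as : Args S ty (.arr σ τ)} {p : A.Col × A.den σ} :
    p ∈ (show Finset (A.Col × A.den σ) from (A.usageAt term state E _ x as).1) ↔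
      ∃ y bs, Reach E x p.1 y ∧ term y = Args.apply as.head bs ∧
        p.2 = A.usageAt term state E σ y bs := by
  rw [usageAt, Set.Finite.mem_toFinset, Set.mem_ofPred_eq]

theorem spine_usageAt_snd {x : X} : ∀ (n : ℕ) (as : Args S ty (Ty.first n)),
    (A.spine n (A.usageAt term state E _ x as)).2 = state x
  | 0, _ => rfl
  | n + 1, as => spine_usageAt_snd n as.tail

theorem mem_spine_usageAt {x y : X} {c : A.Col} (hr : Reach E x c y) :
    ∀ (n : ℕ) (as : Args S ty (Ty.first n)) (k : Fin n), term y = as.get k →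
      (c, state y) ∈ (A.spine n (A.usageAt term state E _ x as)).1 k
  | 0, _, k, _ => k.elim0
  | n + 1, as, k, hy => by
    induction k using Fin.cases with
    | zero => exact mem_usageAt.2 ⟨y, .nil, hr, hy, rfl⟩
    | succ k => exact mem_spine_usageAt hr n as.tail k hy

variable [Finite N]

variable (A term state E) in
/-- The vertex `y` is headed by the variable or non-terminal that the element of the context
belongs to, and that element describes this occurrence. -/
def IsUsage (y : X) : ∀ (Γ : List Ty), Env S ty Γ → A.denCtx ty Γ → Prop
  | [], _, e => ∃ bs, term y = Args.apply (.nt e.1) bs ∧ e.2 = A.usageAt term state E _ y bs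
  | σ :: _, ρ, .inl b =>
    ∃ bs, term y = Args.apply (ρ σ .zero) bs ∧ b = A.usageAt term state E _ y bs
  | _ :: Γ, ρ, .inr e => IsUsage y Γ (fun _ x => ρ _ x.succ) e

variable (A term state E) in
/-- The elements of the context that are used below `x`, with the greatest colour on the way from
`x` to their use. -/
noncomputable def contextAt {Γ : List Ty} (x : X) (ρ : Env S ty Γ) :
    Finset (A.Col × A.denCtx ty Γ) :=
  (Set.toFinite {p : A.Col × A.denCtx ty Γ | ∃ y, Reach E x p.1 y ∧
    A.IsUsage term state E y Γ ρ p.2}).toFinset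

theorem mem_contextAt {Γ : List Ty} {x : X} {ρ : Env S ty Γ} {p : A.Col × A.denCtx ty Γ} :
    p ∈ A.contextAt term state E x ρ ↔
      ∃ y, Reach E x p.1 y ∧ A.IsUsage term state E y Γ ρ p.2 := by
  rw [contextAt, Set.Finite.mem_toFinset, Set.mem_ofPred_eq]

theorem exists_isUsage_var {Γ : List Ty} {σ : Ty} (z : Var Γ σ) (ρ : Env S ty Γ) {x : X}
    {as : Args S ty σ} (h : term x = as.apply (ρ _ z)) :
    ∃ e, A.IsUsage term state E x Γ ρ e ∧
      (A.projVar ty z).rel e (A.usageAt term state E σ x as) := by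
  induction z with
  | zero => exact ⟨Sum.inl _, ⟨as, h, rfl⟩, _, rfl, le_rfl⟩
  | succ z ih =>
    obtain ⟨e, he, hR⟩ := ih (fun _ x => ρ _ x.succ) h
    exact ⟨Sum.inr e, he, e, ⟨e, rfl, le_rfl⟩, hR⟩

theorem exists_isUsage_nt {F : N} {x : X} {as : Args S ty (ty F)}
    (h : term x = as.apply (.nt F)) : ∀ {Γ : List Ty} (ρ : Env S ty Γ),
      ∃ e, A.IsUsage term state E x Γ ρ e ∧
        (A.projNT ty F Γ).rel e (A.usageAt term state E _ x as)
  | [], _ => ⟨⟨F, A.usageAt term state E _ x as⟩, ⟨as, h, rfl⟩, _, rfl, le_rfl⟩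
  | _ :: _, ρ => by
    obtain ⟨e, he, hR⟩ := exists_isUsage_nt h fun _ x => ρ _ x.succ
    exact ⟨Sum.inr e, he, e, ⟨e, rfl, le_rfl⟩, hR⟩

end Usage

section

variable {S : Sig} {A : APT S} {G : HORS S} {X : Type*} {term : X → Term S G.ty [] .o}
  {state : X → A.Q} {E : X → A.Col → X → Prop}

theorem Responds.sat_usageAt {x : X} {a : S.sym} {as : Args S G.ty (Ty.first (S.ar a))}
    (h : A.Responds G term state E x a as) :
    A.Sat (A.spine _ (A.usageAt term state E _ x as)).2 a
      (A.spine _ (A.usageAt term state E _ x as)).1 := by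
  obtain ⟨φ, hφ, hmove⟩ := h
  refine ⟨φ, (spine_usageAt_snd _ as).symm ▸ hφ, fun k q hk => ?_⟩
  obtain ⟨y, hE, hterm, rfl⟩ := hmove (k, q) hk
  exact mem_spine_usageAt (.inr (.single hE)) _ as k hterm

namespace IsEvalStrategy

theorem denTerm_rel (h : A.IsEvalStrategy G term state E G.HeadStep) {Γ : List Ty} {σ : Ty}
    (M : Term S G.ty Γ σ) (ρ : Env S G.ty Γ) {x : X} {as : Args S G.ty σ}
    (hx : term x = as.apply (M.subst ρ)) :
    (A.denTerm G.ty M).rel (A.contextAt term state E x ρ) (A.usageAt term state E σ x as) := by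
  induction M generalizing x with
  | const a => exact (h.responds hx).sat_usageAt
  | nt F =>
    obtain ⟨e, he, hR⟩ := exists_isUsage_nt hx ρ
    exact der_comp_rel.2 ⟨e, mem_contextAt.2 ⟨x, .refl x, he⟩, hR⟩
  | var z =>
    obtain ⟨e, he, hR⟩ := exists_isUsage_var z ρ hx
    exact der_comp_rel.2 ⟨e, mem_contextAt.2 ⟨x, .refl x, he⟩, hR⟩
  | app M P ihM ihP =>
    refine apply_rel.2 ⟨_, ihM (as := .cons (P.subst ρ) as) hx, fun p hp => ?_⟩
    obtain ⟨y, bs, hr, hy, hp⟩ := mem_usageAt.1 hp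
    rw [hp]
    refine (A.denTerm G.ty P).down (ihP hy) (bang_le_of_subset fun z hz => ?_) le_rfl
    obtain ⟨y', hr', hy'⟩ := mem_contextAt.1 hz
    exact mem_shift.2 (mem_contextAt.2 ⟨y', hr.trans hr', hy'⟩)

theorem denRule_rel (h : A.IsEvalStrategy G term state E G.HeadStep) {Γ : List Ty} {σ : Ty}
    (r : Rule S G.ty Γ σ) (ρ : Env S G.ty Γ) {x x' : X} {as : Args S G.ty σ}
    (hx : term x' = r.inst ρ as) (hE : E x ⊥ x') (hstate : state x' = state x) :
    (A.denRule G.ty r).rel (A.contextAt term state E x' ρ) (A.usageAt term state E σ x as) := by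
  induction r with
  | body t =>
    cases as
    have husage : A.usageAt term state E .o x .nil = A.usageAt term state E .o x' .nil :=
      hstate.symm
    exact husage ▸ h.denTerm_rel t ρ (as := .nil) hx
  | lam r ih =>
    cases as with
    | cons P as =>
      refine (A.denRule G.ty r).down (ih (Env.cons P ρ) hx) (bang_le_of_subset ?_) le_rfl
      rintro ⟨c, b | e⟩ hz
      · obtain ⟨y, hr, bs, hy, hb⟩ := mem_contextAt.1 hz
        exact A.mem_seely_inl.2 (mem_usageAt.2 ⟨y, bs, .inr (Reach.cons_bot hE hr), hy, hb⟩)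
      · obtain ⟨y, hr, hy⟩ := mem_contextAt.1 hz
        exact A.mem_seely_inr.2 (mem_contextAt.2 ⟨y, hr, hy⟩)

end IsEvalStrategy

variable (term) in
/-- An occurrence of a non-terminal at the head of the term at some vertex. -/
structure Call where
  vertex : X
  nt : G.N
  args : Args S G.ty (G.ty nt)
  term_eq : term vertex = args.apply (.nt nt)

theorem IsEvalStrategy.isFixStrategy (h : A.IsEvalStrategy G term state E G.HeadStep) :
    A.IsFixStrategy (A.ruleHom G) (W := Call term)
      (fun w => ⟨w.nt, A.usageAt term state E _ w.vertex w.args⟩)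
      fun w c w' => Path E w.vertex c w'.vertex := by
  refine ⟨fun ⟨x, F, as, hx⟩ => ?_, fun w c hw => h.win.path _ c hw⟩
  obtain ⟨x', hE, hx', hstate⟩ := h.headStep (hx ▸ HORS.HeadStep.rule F as)
  refine ⟨_, ?_, h.denRule_rel (G.rule F) Env.nil hx' hE hstate⟩
  rintro ⟨c, ⟨F', a⟩⟩ hp
  obtain ⟨y, hr, bs, hy, ha⟩ := mem_contextAt.1 hp
  exact ⟨⟨y, F', bs, hy⟩, Reach.cons_bot hE hr, congrArg (Sigma.mk F') ha.symm⟩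

end

section Start

variable {S : Sig}

theorem usageAt_cast {A : APT S} {N : Type} {ty : N → Ty} {X : Type*}
    (term : X → Term S ty [] .o) (state : X → A.Q) (E : X → A.Col → X → Prop) (x : X) {σ : Ty}
    (h : σ = .o) : A.usageAt term state E σ x (h.symm ▸ Args.nil) =
      h.symm ▸ (show A.den .o from state x) := by
  subst h
  rfl

theorem mem_interp_of_accepts {A : APT S} {G : HORS S} {q₀ : A.Q}
    (h : A.Accepts G.valueTree q₀) : q₀ ∈ A.interp G := by
  obtain ⟨X, term, state, E, x₀, hE, hx₀, rfl⟩ := exists_isEvalStrategy_of_accepts h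
  have hfix := hE.isFixStrategy.fixRel_empty
    ⟨x₀, G.start, G.start_ty.symm ▸ .nil, hx₀.trans (Args.apply_cast G.start_ty _).symm⟩
  rwa [usageAt_cast term state E x₀ G.start_ty] at hfix

end Start

/-! ### From the model to acceptance -/

section Projections

variable {X Y Z : FinScottL} {a a' : X} {b : Y} {c : Z}

theorem fst_rel_inl : (fst X Y).rel (Sum.inl a) a' ↔ a' ≤ a :=
  ⟨fun ⟨_, ha, hle⟩ => (Sum.inl_injective ha).symm ▸ hle, fun hle => ⟨a, rfl, hle⟩⟩

theorem not_fst_rel_inr : ¬ (fst X Y).rel (Sum.inr b) a := fun ⟨_, h, _⟩ => Sum.inr_ne_inl h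

theorem snd_comp_rel_inr {R : Y ⟶ Z} : (snd X Y ≫ R).rel (Sum.inr b) c ↔ R.rel b c :=
  ⟨fun ⟨_, ⟨_, hb, hle⟩, hR⟩ => R.down hR (Sum.inr_injective hb ▸ hle) le_rfl,
    fun hR => ⟨b, ⟨b, rfl, le_rfl⟩, hR⟩⟩

theorem not_snd_comp_rel_inl {R : Y ⟶ Z} : ¬ (snd X Y ≫ R).rel (Sum.inl a) c :=
  fun ⟨_, ⟨_, h, _⟩, _⟩ => Sum.inl_ne_inr h

end Projections

variable {S : Sig} {A : APT S}

/-- The state `q` at the end of an element `u₁ → ⋯ → uₙ → q` of the interpretation of a type. -/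
def target : ∀ {σ : Ty}, A.den σ → A.den .o
  | .o, q => q
  | .arr _ _, x => target x.2

theorem target_eq_of_le : ∀ {σ : Ty} {x y : A.den σ}, x ≤ y → target x = target y
  | .o, _, _, h => h
  | .arr _ τ, _, _, h => target_eq_of_le (σ := τ) h.2

theorem spine_snd : ∀ (n : ℕ) (x : A.den (Ty.first n)), (A.spine n x).2 = target x
  | 0, _ => rfl
  | n + 1, x => spine_snd n x.2

section Derivations

variable {N : Type} [Finite N] {ty : N → Ty} {W : Type*}

/-- Derivations of an element of the interpretation of its type for a closed term. An element for a
non-terminal is justified by a vertex of the fixpoint game that is labelled by it. Derivations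
are data, as they serve as positions of an abstract machine. -/
inductive Derivation (lab : W → A.denNT ty) : ∀ {σ : Ty}, Term S ty [] σ → A.den σ → Type _
  | const {a : S.sym} {x : A.den (Ty.first (S.ar a))}
      (h : A.Sat (A.spine _ x).2 a (A.spine _ x).1) : Derivation lab (.const a) x
  | nt {F : N} {x : A.den (ty F)} {w : W} (h : lab w = ⟨F, x⟩) : Derivation lab (.nt F) x
  | app {σ τ : Ty} {M : Term S ty [] (.arr σ τ)} {P : Term S ty [] σ}
      {v : Finset (A.Col × A.den σ)} {x : A.den τ}
      (D : Derivation lab M (show A.den (.arr σ τ) from (v, x)))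
      (B : ∀ p ∈ v, Derivation lab P p.2) : Derivation lab (.app M P) x
  | sub {σ : Ty} {M : Term S ty [] σ} {x y : A.den σ} (h : x ≤ y) (D : Derivation lab M y) :
      Derivation lab M x

variable (lab : W → A.denNT ty)

/-- Derivations for the arguments of a term, one for each element that `u₁ → ⋯ → uₙ → q` demands of
them. -/
def ArgsDerivation : ∀ {σ : Ty}, Args S ty σ → A.den σ → Type _
  | _, .nil, _ => PUnit
  | .arr σ _, .cons P as, x =>
    (∀ p ∈ (show Finset (A.Col × A.den σ) from x.1), Derivation lab P p.2) ×
      ArgsDerivation as x.2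

/-- Justifications for an element of a context: a derivation for the term that is substituted for a
variable, or a vertex of the fixpoint game for a non-terminal. -/
def EnvDerivation : ∀ {Γ : List Ty}, Env S ty Γ → A.denCtx ty Γ → Type _
  | [], _, e => {w : W // lab w = e}
  | σ :: _, ρ, .inl b => Derivation lab (ρ σ .zero) b
  | _ :: _, ρ, .inr e => EnvDerivation (fun _ x => ρ _ x.succ) e

variable {lab}

namespace ArgsDerivation

/-- Derivations for a list of arguments with one more argument in front. -/
def push {σ τ : Ty} {P : Term S ty [] σ} {as : Args S ty τ} {v : Finset (A.Col × A.den σ)}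
    {x : A.den τ} (B : ∀ p ∈ v, Derivation lab P p.2) (π : ArgsDerivation lab as x) :
    ArgsDerivation lab (.cons P as) (show A.den (.arr σ τ) from (v, x)) := (B, π)

/-- A greater element demands less of the arguments. -/
noncomputable def raise : ∀ {σ : Ty} {as : Args S ty σ} {x y : A.den σ}, x ≤ y →
    ArgsDerivation lab as x → ArgsDerivation lab as y
  | _, .nil, _, _, _, _ => ⟨⟩
  | .arr _ _, .cons _ _, _, _, h, π =>
    (fun p hp => .sub (h.1 p hp).choose_spec.2.2 (π.1 _ (h.1 p hp).choose_spec.1), raise h.2 π.2)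

/-- The derivation for an argument of a symbol. -/
noncomputable def get : ∀ {n : ℕ} {as : Args S ty (Ty.first n)} {x : A.den (Ty.first n)},
    ArgsDerivation lab as x → ∀ (k : Fin n) (p : A.Col × A.Q), p ∈ (A.spine n x).1 k →
      Derivation lab (as.get k) (show A.den .o from p.2)
  | 0, _, _, _, k, _, _ => k.elim0
  | _ + 1, .cons _ _, _, π, ⟨0, _⟩, p, hp => π.1 p hp
  | _ + 1, .cons _ _, _, π, ⟨k + 1, hk⟩, p, hp => get π.2 ⟨k, Nat.lt_of_succ_lt_succ hk⟩ p hp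

end ArgsDerivation

namespace EnvDerivation

/-- The derivation for the term that is substituted for a variable. -/
noncomputable def var : ∀ {Γ : List Ty} {σ : Ty} (z : Var Γ σ) {ρ : Env S ty Γ}
    {e : A.denCtx ty Γ} {x : A.den σ}, (A.projVar ty z).rel e x → EnvDerivation lab ρ e →
      Derivation lab (ρ _ z) x
  | _, _, .zero, _, .inl _, _, h, D => .sub (fst_rel_inl.1 h) D
  | _, _, .zero, _, .inr _, _, h, _ => (not_fst_rel_inr h).elim
  | _, _, .succ _, _, .inl _, _, h, _ => (not_snd_comp_rel_inl h).elim
  | _, _, .succ z, _, .inr _, _, h, D => var z (snd_comp_rel_inr.1 h) D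

/-- The derivation for a non-terminal. -/
noncomputable def nt (F : N) : ∀ {Γ : List Ty} {ρ : Env S ty Γ} {e : A.denCtx ty Γ}
    {x : A.den (ty F)}, (A.projNT ty F Γ).rel e x → EnvDerivation lab ρ e →
      Derivation lab (.nt F) x
  | [], _, _, _, h, D => .sub h.choose_spec.2 (.nt (D.2.trans h.choose_spec.1))
  | _ :: _, _, .inl _, _, h, _ => (not_snd_comp_rel_inl h).elim
  | _ :: Γ, _, .inr _, _, h, D => nt F (Γ := Γ) (snd_comp_rel_inr.1 h) D

/-- Justifications for a context, extended by derivations for an argument. -/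
noncomputable def cons {Γ : List Ty} {σ : Ty} {P : Term S ty [] σ} {ρ : Env S ty Γ}
    {v : Finset (A.Col × A.den σ)} {u : Finset (A.Col × A.denCtx ty Γ)}
    (B : ∀ p ∈ v, Derivation lab P p.2) (env : ∀ p ∈ u, EnvDerivation lab ρ p.2) :
    ∀ p ∈ (show Finset (A.Col × A.denCtx ty (σ :: Γ)) from A.seely v u),
      EnvDerivation lab (Env.cons P ρ) p.2
  | (_, .inl _), hp => B _ (A.mem_seely_inl.1 hp)
  | (_, .inr _), hp => env _ (A.mem_seely_inr.1 hp)

end EnvDerivation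

namespace Derivation

/-- The derivation for a closed instance of a term, read off from its interpretation. -/
noncomputable def ofTerm : ∀ {Γ : List Ty} {σ : Ty} (M : Term S ty Γ σ) {ρ : Env S ty Γ}
    {u : Finset (A.Col × A.denCtx ty Γ)} {x : A.den σ}, (A.denTerm ty M).rel u x →
      (∀ p ∈ u, EnvDerivation lab ρ p.2) → Derivation lab (M.subst ρ) x
  | _, _, .const _, _, _, _, h, _ => .const h
  | _, _, .nt F, _, _, _, h, env =>
    EnvDerivation.nt F (der_comp_rel.1 h).choose_spec.2 (env _ (der_comp_rel.1 h).choose_spec.1)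
  | _, _, .var z, _, _, _, h, env =>
    EnvDerivation.var z (der_comp_rel.1 h).choose_spec.2 (env _ (der_comp_rel.1 h).choose_spec.1)
  | _, _, .app M P, _, _, _, h, env =>
    .app (ofTerm M (apply_rel.1 h).choose_spec.1 env) fun p hp =>
      ofTerm P ((apply_rel.1 h).choose_spec.2 p hp) fun z hz =>
        env (max p.1 z.1, z.2) (mem_shift.1 hz)

/-- The derivation for a closed instance of the body of a rule, read off from the interpretation of
the rule. -/
noncomputable def ofRule : ∀ {Γ : List Ty} {σ : Ty} (r : Rule S ty Γ σ) {ρ : Env S ty Γ}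
    {u : Finset (A.Col × A.denCtx ty Γ)} {x : A.den σ}, (A.denRule ty r).rel u x →
      (∀ p ∈ u, EnvDerivation lab ρ p.2) → ∀ {as : Args S ty σ}, ArgsDerivation lab as x →
        Derivation lab (r.inst ρ as) (target x)
  | _, _, .body t, _, _, _, h, env, .nil, _ => ofTerm t h env
  | _, _, .lam r, _, _, _, h, env, .cons _ _, π => ofRule r h (EnvDerivation.cons π.1 env) π.2

end Derivation

variable (lab) in
/-- A configuration of the abstract machine: a derivation for a closed term together with
derivations for its arguments. -/
structure Config where
  {type : Ty}
  {head : Term S ty [] type}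
  {elt : A.den type}
  derivation : Derivation lab head elt
  {args : Args S ty type}
  stack : ArgsDerivation lab args elt

namespace Config

/-- The closed term that the machine evaluates. -/
def term (s : Config lab) : Term S ty [] .o := s.args.apply s.head

/-- The state in which the automaton has to accept the tree of `s.term`. -/
def state (s : Config lab) : A.Q := target s.elt

/-- The configuration of a term of ground type, which has no arguments. -/
def ground {t : Term S ty [] .o} {q : A.den .o} (D : Derivation lab t q) : Config lab :=
  ⟨D, (show ArgsDerivation lab .nil q from ⟨⟩)⟩

end Config

end Derivations

section Machine

variable {G : HORS S} {W : Type*} {lab : W → A.denNT G.ty} {E : W → A.Col → W → Prop}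

namespace IsFixStrategy

variable (h : A.IsFixStrategy (A.ruleHom G) lab E)

/-- The elements that a fixpoint strategy uses to derive the label of `w`. -/
noncomputable def context (w : W) : Finset (A.Col × A.denNT G.ty) := (h.step w).choose

/-- The vertex to which a fixpoint strategy moves for an element of the context of `w`. -/
noncomputable def next {w : W} {p : A.Col × A.denNT G.ty} (hp : p ∈ h.context w) : W :=
  ((h.step w).choose_spec.1 p hp).choose

theorem edge_next {w : W} {p : A.Col × A.denNT G.ty} (hp : p ∈ h.context w) :
    E w p.1 (h.next hp) :=
  ((h.step w).choose_spec.1 p hp).choose_spec.1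

theorem lab_next {w : W} {p : A.Col × A.denNT G.ty} (hp : p ∈ h.context w) :
    lab (h.next hp) = p.2 :=
  ((h.step w).choose_spec.1 p hp).choose_spec.2

theorem denRule_rel_context {w : W} {F : G.N} {x : A.den (G.ty F)} (hw : lab w = ⟨F, x⟩) :
    (A.denRule G.ty (G.rule F)).rel (h.context w) x := by
  have hrel : (A.ruleHom G).rel ((∅ : Finset (A.Col × top)), h.context w) (lab w) :=
    (h.step w).choose_spec.2
  rwa [hw] at hrel

/-- The derivation for the term that a head occurrence of a non-terminal is rewritten to. -/
noncomputable def unfold {F : G.N} {x : A.den (G.ty F)} {w : W} (hw : lab w = ⟨F, x⟩)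
    {as : Args S G.ty (G.ty F)} (π : ArgsDerivation lab as x) :
    Derivation lab ((G.rule F).inst Env.nil as) (target x) :=
  .ofRule (G.rule F) (ρ := Env.nil) (h.denRule_rel_context hw)
    (fun p hp => (⟨h.next hp, h.lab_next hp⟩ : {w' : W // lab w' = p.2})) π

/-- The moves from the configuration that consists of a derivation and a stack of arguments. -/
def MoveFrom : ∀ {σ : Ty} {M : Term S G.ty [] σ} {x : A.den σ}, Derivation lab M x →
    ∀ {as : Args S G.ty σ}, ArgsDerivation lab as x → A.Col → Config lab → Prop
  | _, _, _, .app D B, _, π, c, s => c = ⊥ ∧ s = ⟨D, .push B π⟩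
  | _, _, _, .sub hle D, _, π, c, s => c = ⊥ ∧ s = ⟨D, .raise hle π⟩
  | _, _, _, .nt hw, _, π, c, s => c = ⊥ ∧ s = .ground (h.unfold hw π)
  | _, _, _, .const hsat, _, π, c, s => ∃ (k : _) (q : A.Q) (hk : (k, q) ∈ hsat.choose),
    c = A.col q ∧ s = .ground (π.get k (A.col q, q) (hsat.choose_spec.2 k q hk))

/-- The moves of the abstract machine: it looks for the head of the term, unfolds a non-terminal,
and proceeds to an argument of a symbol, with the colour of the new state of the automaton. -/
def Move (s : Config lab) : A.Col → Config lab → Prop := h.MoveFrom s.derivation s.stack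

theorem move_step (s : Config lab) :
    (∃ s', h.Move s ⊥ s' ∧ Relation.ReflGen G.HeadStep s.term s'.term ∧ s'.state = s.state) ∨
    ∃ a as, s.term = Args.apply (.const a) as ∧
      A.Responds G Config.term Config.state h.Move s a as := by
  obtain ⟨D, π⟩ := s
  cases D with
  | const hsat =>
    refine .inr ⟨_, _, rfl, hsat.choose, ?_, fun ⟨d, q⟩ hdq => ?_⟩
    · change hsat.choose ∈ A.δ (target _) _
      rw [← spine_snd]
      exact hsat.choose_spec.1
    · exact ⟨_, ⟨d, q, hdq, rfl, rfl⟩, rfl, rfl⟩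
  | nt hw => exact .inl ⟨_, ⟨rfl, rfl⟩, .single (.rule _ _), rfl⟩
  | app D B => exact .inl ⟨_, ⟨rfl, rfl⟩, .refl, rfl⟩
  | sub hle D => exact .inl ⟨_, ⟨rfl, rfl⟩, .refl, (target_eq_of_le hle).symm⟩

end IsFixStrategy

end Machine

end APT

/-! ### Losing plays -/

/-- The set `T` of indexed vertices contains the tail of a play with limit colour `c`: from each of
its elements there is an edge inside `T` with a colour that does not exceed `c`. The index bounds
the number of edges until the next occurrence of the colour `c`; it is only reset after an edge of
this colour, and never by a neutral edge. -/
def IsTail {X C : Type*} [LinearOrder C] [OrderBot C] (c : C) (E : X → C → X → Prop)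
    (T : ℕ → X → Prop) : Prop :=
  ∀ k x, T k x → ∃ d y j, E x d y ∧ d ≤ c ∧ T j y ∧ (d < c → j < k) ∧ (d = ⊥ → j ≤ k)

open Filter in
theorem IsLimitColour.exists_isTail {X C : Type*} [LinearOrder C] [OrderBot C]
    {E : X → C → X → Prop} {x : ℕ → X} {s : ℕ → C} (hE : ∀ n, E (x n) (s n) (x (n + 1))) {c : C}
    (hc : IsLimitColour s c) : ∃ T, IsTail c E T ∧ ∃ k y, T k y := by
  obtain ⟨N, hN⟩ := eventually_atTop.1 hc.2
  have hnext : ∀ n, ∃ i, s (n + i) = c := fun n =>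
    (frequently_atTop.1 hc.frequently_eq n).imp' (· - n) fun m ⟨hm, hs⟩ => by
      rwa [Nat.add_sub_cancel' hm]
  let wait (n : ℕ) : ℕ := Nat.find (hnext n)
  have hlt : ∀ n, s n < c → wait (n + 1) < wait n := by
    intro n hn
    have hspec : s (n + wait n) = c := Nat.find_spec (hnext n)
    obtain ⟨i, hi⟩ : ∃ i, wait n = i + 1 := by
      refine Nat.exists_eq_succ_of_ne_zero fun h0 => hn.ne ?_
      rwa [h0] at hspec
    rw [hi] at hspec ⊢
    exact Nat.lt_succ_of_le (Nat.find_min' _ (by rwa [Nat.add_right_comm, Nat.add_assoc]))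
  refine ⟨fun k y => ∃ n ≥ N, x n = y ∧ wait n = k, ?_, wait N, x N, N, le_rfl, rfl, rfl⟩
  rintro _ _ ⟨n, hn, rfl, rfl⟩
  refine ⟨s n, x (n + 1), wait (n + 1), hE n, hN n hn, ⟨n + 1, hn.trans n.le_succ, rfl, rfl⟩,
    hlt n, fun hbot => ?_⟩
  rcases (bot_le (a := c)).eq_or_lt with rfl | hpos
  · have hs : s (n + 1 + 0) = ⊥ := le_bot_iff.1 (hN (n + 1) (hn.trans n.le_succ))
    exact (Nat.find_min' _ hs).trans (Nat.zero_le _)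
  · exact (hlt n (hbot ▸ hpos)).le

/-- `P` holds at all the levels at which something that is available at level `k` can be used in a
play with limit colour `c`, if it is used with the colour `d`: the level is arbitrary once `c` has
occurred, and has not increased before. -/
def AtLevels {C : Type*} [LinearOrder C] (c d : C) (k : ℕ) (P : ℕ → Prop) : Prop :=
  ∀ j, d ≤ c → (d = c ∨ j ≤ k) → P j

namespace AtLevels

variable {C : Type*} [LinearOrder C] {c d : C} {k k' : ℕ} {P : ℕ → Prop}

theorem mono (h : AtLevels c d k P) (hk : k' ≤ k) : AtLevels c d k' P :=
  fun j hd hj => h j hd (hj.imp_right hk.trans')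

theorem max {d' : C} {j : ℕ} (h : AtLevels c (max d d') k P) (hd : d ≤ c) (hj : d = c ∨ j ≤ k) :
    AtLevels c d' j P := by
  intro i hd' hi
  refine h i (max_le hd hd') ?_
  rcases hj with rfl | hj
  · exact .inl (max_eq_left hd')
  · rcases hi with rfl | hi
    · exact .inl (max_eq_right hd)
    · exact .inr (hi.trans hj)

theorem bot [OrderBot C] (h : AtLevels c ⊥ k P) : P k := h k bot_le (.inr le_rfl)

end AtLevels

namespace APT

open FinScottL

variable {S : Sig} {A : APT S} {c : A.Col}

section Safe

variable {N : Type} [Finite N] {ty : N → Ty} {W : Type*} {lab : W → A.denNT ty}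
  (c : A.Col) (T : ℕ → Config lab → Prop)

/-- Derivations for arguments that cannot lead the machine into `T`: none of them does, together
with a safe stack, at any level at which it can be used. -/
def ArgsDerivation.Safe : ∀ {σ : Ty} (_ : ℕ) {as : Args S ty σ} {x : A.den σ},
    ArgsDerivation lab as x → Prop
  | .o, _, _, _, _ => True
  | .arr σ _, k, .cons _ _, x, π =>
    (∀ p (hp : p ∈ (show Finset (A.Col × A.den σ) from x.1)), AtLevels c p.1 k fun j =>
      ∀ {as' : Args S ty σ} (π' : ArgsDerivation lab as' p.2), Safe j π' → ¬ T j ⟨π.1 p hp, π'⟩) ∧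
    Safe k π.2

/-- The logical relation on derivations: at levels up to `k`, the machine is not in `T` when it
evaluates the derivation on a safe stack. -/
def Derivation.Safe {σ : Ty} {M : Term S ty [] σ} {x : A.den σ} (k : ℕ)
    (D : Derivation lab M x) : Prop :=
  ∀ i ≤ k, ∀ {as : Args S ty σ} (π : ArgsDerivation lab as x), π.Safe c T i → ¬ T i ⟨D, π⟩

/-- Justifications by safe derivations, where a vertex of the fixpoint game stands for the
derivation of its label. -/
def EnvDerivation.Safe (k : ℕ) : ∀ {Γ : List Ty} {ρ : Env S ty Γ} {e : A.denCtx ty Γ},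
    EnvDerivation lab ρ e → Prop
  | [], _, _, w => (Derivation.nt w.2).Safe c T k
  | _ :: _, _, .inl _, D => Derivation.Safe c T k D
  | _ :: Γ, _, .inr _, D => Safe k (Γ := Γ) D

variable {c T}

namespace ArgsDerivation

theorem safe_cons {σ τ : Ty} {k : ℕ} {P : Term S ty [] σ} {as : Args S ty τ} {x : A.den (.arr σ τ)}
    {π : ArgsDerivation lab (.cons P as) x} :
    π.Safe c T k ↔ (∀ p (hp : p ∈ (show Finset (A.Col × A.den σ) from x.1)),
      AtLevels c p.1 k fun j => (π.1 p hp).Safe c T j) ∧ π.2.Safe c T k := by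
  refine and_congr_left fun _ => forall_congr' fun p => forall_congr' fun hp => ?_
  exact ⟨fun h j hd hj i hi as π' => h i hd (hj.imp_right hi.trans) π',
    fun h j hd hj as π' => h j hd hj j le_rfl π'⟩

theorem Safe.nil {k : ℕ} {q : A.den .o} {π : ArgsDerivation lab .nil q} : π.Safe c T k := trivial

theorem Safe.mono {σ : Ty} {as : Args S ty σ} {x : A.den σ} {π : ArgsDerivation lab as x} {k k' : ℕ}
    (h : π.Safe c T k) (hk : k' ≤ k) : π.Safe c T k' := by
  induction as with
  | nil => trivial
  | cons P as ih =>
    rw [safe_cons] at h ⊢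
    exact ⟨fun p hp => (h.1 p hp).mono hk, ih h.2⟩

theorem Safe.get {n : ℕ} {as : Args S ty (Ty.first n)} {x : A.den (Ty.first n)}
    {π : ArgsDerivation lab as x} {k : ℕ} (h : π.Safe c T k) (i : Fin n) {p : A.Col × A.Q}
    (hp : p ∈ (A.spine n x).1 i) : AtLevels c p.1 k fun j => (π.get i p hp).Safe c T j := by
  induction n with
  | zero => exact i.elim0
  | succ n ih =>
    cases as with
    | cons P as =>
      obtain ⟨h1, h2⟩ := safe_cons.1 h
      obtain ⟨_ | i, hi⟩ := i
      · exact h1 p hp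
      · exact ih h2 ⟨i, _⟩ hp

end ArgsDerivation

end Safe

section Machine

variable {G : HORS S} {W : Type*} {lab : W → A.denNT G.ty} {E : W → A.Col → W → Prop}
  {h : A.IsFixStrategy (A.ruleHom G) lab E} {T : ℕ → Config lab → Prop}

theorem ArgsDerivation.Safe.raise (hT : IsTail c h.Move T) {σ : Ty} {as : Args S G.ty σ}
    {x y : A.den σ} {π : ArgsDerivation lab as x} {k : ℕ} (hπ : π.Safe c T k) (hle : x ≤ y) :
    (π.raise hle).Safe c T k := by
  induction σ generalizing k with
  | o => trivial
  | arr σ τ ihσ ihτ =>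
    cases as with
    | cons P as =>
      refine ⟨fun p hp j hd hj as' π' hπ' ht => ?_, ihτ hπ.2 hle.2⟩
      obtain ⟨hp', hcol : p.1 = (hle.1 p hp).choose.1, hle'⟩ := (hle.1 p hp).choose_spec
      obtain ⟨_, _, i, ⟨rfl, rfl⟩, -, ht', -, hi⟩ := hT _ _ ht
      have hij : i ≤ j := hi rfl
      refine hπ.1 _ hp' i (hcol ▸ hd) ?_ _ (ihσ (hπ'.mono hij) hle') ht'
      rw [← hcol]
      exact hj.imp_right hij.trans

namespace Derivation

theorem safe_app (hT : IsTail c h.Move T) {σ τ : Ty} {M : Term S G.ty [] (.arr σ τ)}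
    {P : Term S G.ty [] σ} {v : Finset (A.Col × A.den σ)} {x : A.den τ}
    {D : Derivation lab M (show A.den (.arr σ τ) from (v, x))} {B : ∀ p ∈ v, Derivation lab P p.2}
    {k : ℕ} (hD : D.Safe c T k) (hB : ∀ p hp, AtLevels c p.1 k fun j => (B p hp).Safe c T j) :
    (app D B).Safe c T k := by
  intro i hi as π hπ ht
  obtain ⟨_, _, j, ⟨rfl, rfl⟩, -, ht', -, hj⟩ := hT _ _ ht
  have hji : j ≤ i := hj rfl
  refine hD j (hji.trans hi) (.push B π) ?_ ht'
  exact (ArgsDerivation.safe_cons (π := .push B π)).2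
    ⟨fun p hp => (hB p hp).mono (hji.trans hi), hπ.mono hji⟩

theorem safe_sub (hT : IsTail c h.Move T) {σ : Ty} {M : Term S G.ty [] σ} {x y : A.den σ}
    {D : Derivation lab M y} {k : ℕ} (hD : D.Safe c T k) (hle : x ≤ y) :
    (sub hle D).Safe c T k := by
  intro i hi as π hπ ht
  obtain ⟨_, _, j, ⟨rfl, rfl⟩, -, ht', -, hj⟩ := hT _ _ ht
  have hji : j ≤ i := hj rfl
  exact hD j (hji.trans hi) _ ((hπ.mono hji).raise hT hle) ht'

theorem safe_const (hT : IsTail c h.Move T) {a : S.sym} {x : A.den (Ty.first (S.ar a))}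
    {hsat : A.Sat (A.spine _ x).2 a (A.spine _ x).1} {k : ℕ} :
    (const (lab := lab) hsat).Safe c T k := by
  intro i _ as π hπ ht
  obtain ⟨_, _, j, ⟨m, q, hm, rfl, rfl⟩, hd, ht', hlt, -⟩ := hT _ _ ht
  exact hπ.get m (p := (A.col q, q)) (hsat.choose_spec.2 m q hm) j hd
    (hd.eq_or_lt.imp_right fun hd => (hlt hd).le) j le_rfl _ .nil ht'

end Derivation

namespace EnvDerivation

theorem Safe.var (hT : IsTail c h.Move T) {Γ : List Ty} {σ : Ty} (z : Var Γ σ) {ρ : Env S G.ty Γ}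
    {e : A.denCtx G.ty Γ} {x : A.den σ} {hz : (A.projVar G.ty z).rel e x}
    {D : EnvDerivation lab ρ e} {k : ℕ} (hD : D.Safe c T k) : (var z hz D).Safe c T k := by
  induction z with
  | zero =>
    cases e with
    | inl b => exact Derivation.safe_sub hT hD _
    | inr e => exact (not_fst_rel_inr hz).elim
  | succ z ih =>
    cases e with
    | inl b => exact (not_snd_comp_rel_inl hz).elim
    | inr e => exact ih hD

theorem Safe.nt (hT : IsTail c h.Move T) {F : G.N} {Γ : List Ty} {ρ : Env S G.ty Γ}
    {e : A.denCtx G.ty Γ} {x : A.den (G.ty F)} {hF : (A.projNT G.ty F Γ).rel e x}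
    {D : EnvDerivation lab ρ e} {k : ℕ} (hD : D.Safe c T k) : (nt F hF D).Safe c T k := by
  induction Γ with
  | nil =>
    have hsafe : ∀ (e : A.denNT G.ty) (w : W) (hw : lab w = e) (y : A.den (G.ty F))
        (he : e = ⟨F, y⟩), (Derivation.nt (F := e.1) (x := e.2) hw).Safe c T k →
          (Derivation.nt (hw.trans he)).Safe c T k := by
      rintro _ w hw y rfl h
      exact h
    exact Derivation.safe_sub hT (hsafe e D.1 D.2 _ hF.choose_spec.1 hD) _
  | cons σ Γ ih =>
    cases e with
    | inl b => exact (not_snd_comp_rel_inl hF).elim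
    | inr e => exact ih hD

end EnvDerivation

namespace Derivation

theorem safe_ofTerm (hT : IsTail c h.Move T) {Γ : List Ty} {σ : Ty} (M : Term S G.ty Γ σ)
    {ρ : Env S G.ty Γ} {u : Finset (A.Col × A.denCtx G.ty Γ)} {x : A.den σ}
    {hM : (A.denTerm G.ty M).rel u x} {env : ∀ p ∈ u, EnvDerivation lab ρ p.2} {k : ℕ}
    (henv : ∀ p hp, AtLevels c p.1 k fun j => (env p hp).Safe c T j) :
    (ofTerm M hM env).Safe c T k := by
  induction M generalizing u k with
  | const a =>
    rw [ofTerm]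
    exact safe_const hT
  | nt F =>
    rw [ofTerm]
    exact (henv _ (der_comp_rel.1 hM).choose_spec.1).bot.nt hT
  | var z =>
    rw [ofTerm]
    exact (henv _ (der_comp_rel.1 hM).choose_spec.1).bot.var hT z
  | app M P ihM ihP =>
    rw [ofTerm]
    refine safe_app hT (ihM henv) fun p hp j hd hj => ihP fun z hz => ?_
    exact (henv (max p.1 z.1, z.2) (mem_shift.1 hz)).max hd hj

theorem safe_ofRule (hT : IsTail c h.Move T) {Γ : List Ty} {σ : Ty} (r : Rule S G.ty Γ σ)
    {ρ : Env S G.ty Γ} {u : Finset (A.Col × A.denCtx G.ty Γ)} {x : A.den σ}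
    {hr : (A.denRule G.ty r).rel u x} {env : ∀ p ∈ u, EnvDerivation lab ρ p.2}
    {as : Args S G.ty σ} {π : ArgsDerivation lab as x} {k : ℕ}
    (henv : ∀ p hp, AtLevels c p.1 k fun j => (env p hp).Safe c T j) (hπ : π.Safe c T k) :
    (ofRule r hr env π).Safe c T k := by
  induction r with
  | body t =>
    cases as
    exact safe_ofTerm hT t henv
  | lam r ih =>
    cases as with
    | cons P as =>
      obtain ⟨h1, h2⟩ := ArgsDerivation.safe_cons.1 hπ
      refine ih ?_ h2
      rintro ⟨d, b | e⟩ hp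
      · exact h1 _ (A.mem_seely_inl.1 hp)
      · exact henv _ (A.mem_seely_inr.1 hp)

theorem safe_nt_of_next (hT : IsTail c h.Move T) {F : G.N} {x : A.den (G.ty F)} {w : W}
    (hw : lab w = ⟨F, x⟩) {k : ℕ} (hnext : ∀ p (hp : p ∈ h.context w), ∀ j, p.1 ≤ c →
      (p.1 < c → j < k) → (nt (h.lab_next hp)).Safe c T j) : (nt hw).Safe c T k := by
  intro i hi as π hπ ht
  obtain ⟨_, _, j, ⟨rfl, rfl⟩, -, ht', hlt, hle⟩ := hT _ _ ht
  refine safe_ofRule hT (G.rule F) (fun p hp m hd hm => ?_) (hπ.mono (hle rfl)) j le_rfl _ .nil ht'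
  refine hnext p hp m hd fun hd => ?_
  exact (hm.resolve_left hd.ne).trans_lt ((hlt (bot_le.trans_lt hd)).trans_le hi)

/-- Induction on the vertex along paths of greatest colour `c`, and on the level for those paths
which have not seen `c` yet. -/
theorem safe_nt (hT : IsTail c h.Move T) (hwf : WellFounded fun w' w => Path E w c w') (w : W) :
    ∀ {F : G.N} {x : A.den (G.ty F)} (hw : lab w = ⟨F, x⟩) (k : ℕ), (nt hw).Safe c T k := by
  induction w using hwf.induction with
  | _ w ihw =>
    suffices hbelow : ∀ k w', (w' = w ∨ ∃ d < c, Path E w d w') → ∀ {F : G.N} {x : A.den (G.ty F)}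
        (hw' : lab w' = ⟨F, x⟩), (nt hw').Safe c T k from @fun _ _ hw k => hbelow k w (.inl rfl) hw
    intro k
    induction k using Nat.strong_induction_on with
    | _ k ihk =>
      intro w' hpath F x hw'
      refine safe_nt_of_next hT hw' fun p hp j hd hj => ?_
      have hedge : Path E w' p.1 (h.next hp) := .single (h.edge_next hp)
      rcases hd.eq_or_lt with hd | hd
      · refine ihw _ ?_ _ j
        rcases hpath with rfl | ⟨d', hd', hpath⟩
        · exact hd ▸ hedge
        · exact max_eq_right hd'.le ▸ hpath.trans (hd ▸ hedge)
      · refine ihk j (hj hd) _ (.inr ?_) _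
        rcases hpath with rfl | ⟨d', hd', hpath⟩
        · exact ⟨_, hd, hedge⟩
        · exact ⟨_, max_lt hd' hd, hpath.trans hedge⟩

theorem safe (hT : IsTail c h.Move T) (hwf : WellFounded fun w' w => Path E w c w') {σ : Ty}
    {M : Term S G.ty [] σ} {x : A.den σ} (D : Derivation lab M x) (k : ℕ) : D.Safe c T k := by
  induction D generalizing k with
  | const => exact safe_const hT
  | @nt _ _ w hw => exact safe_nt hT hwf w hw k
  | app D B ihD ihB => exact safe_app hT (ihD k) fun p hp j _ _ => ihB p hp j
  | sub hle D ih => exact safe_sub hT (ih k) hle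

end Derivation

theorem ArgsDerivation.safe (hT : IsTail c h.Move T)
    (hwf : WellFounded fun w' w => Path E w c w') {σ : Ty} {as : Args S G.ty σ} {x : A.den σ}
    (π : ArgsDerivation lab as x) (k : ℕ) : π.Safe c T k := by
  induction as with
  | nil => exact .nil
  | cons P as ih => exact safe_cons.2 ⟨fun p hp j _ _ => (π.1 p hp).safe hT hwf j, ih π.2⟩

namespace IsFixStrategy

theorem allPlaysWin_move (h : A.IsFixStrategy (A.ruleHom G) lab E) : A.AllPlaysWin h.Move := by
  intro s cs hs
  obtain ⟨c, hc⟩ := IsLimitColour.exists_of_finite cs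
  by_contra hlose
  have hwf : WellFounded fun w' w => Path E w c w' :=
    h.win.path.wellFounded ((isWinning_iff_const hc).not.1 hlose)
  obtain ⟨T, hT, k, s, hs⟩ := hc.exists_isTail hs
  exact s.derivation.safe hT hwf k k le_rfl s.stack (s.stack.safe hT hwf k) hs

theorem isEvalStrategy_move (h : A.IsFixStrategy (A.ruleHom G) lab E) :
    A.IsEvalStrategy G Config.term Config.state h.Move (Relation.ReflGen G.HeadStep) :=
  ⟨h.move_step, h.allPlaysWin_move⟩

end IsFixStrategy

theorem exists_config_of_derivation_cast {σ : Ty} (hσ : σ = .o) {M : Term S G.ty [] σ} {q : A.Q}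
    (D : Derivation lab M (hσ.symm ▸ (show A.den .o from q))) :
    ∃ s : Config lab, s.term = hσ ▸ M ∧ s.state = q := by
  subst hσ
  exact ⟨.ground D, rfl, rfl⟩

theorem accepts_of_mem_interp {q₀ : A.Q} (h : q₀ ∈ A.interp G) : A.Accepts G.valueTree q₀ := by
  obtain ⟨W, lab, E, w₀, hE, hw₀⟩ := exists_isFixStrategy_of_fixRel_empty h
  obtain ⟨s, hs, rfl⟩ := exists_config_of_derivation_cast G.start_ty (.nt hw₀)
  exact hE.isEvalStrategy_move.accepts (fun _ _ => Relation.ReflGen.to_reflTransGen) hs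

end Machine

end APT

end HOMC

theorem mainTheorem1 (S : HOMC.Sig) (G : HOMC.HORS S) (A : HOMC.APT S) (q₀ : A.Q) :
    A.Accepts G.valueTree q₀ ↔ q₀ ∈ A.interp G :=
  ⟨HOMC.APT.mem_interp_of_accepts, HOMC.APT.accepts_of_mem_interp⟩
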